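/- **Theorem.** Let $t\ge 0$ and $c\ge 1$ be integers, let $H_1,\dots,H_t$ be finite cyclic groups, and let $G=H_1\times\cdots\times H_t$. For a free presentation $1\to R\to F\to G\to 1$ ($F$ a free group), the higher Schur multiplier of $G$ with respect to the variety $\mathcal N_c$ of nilpotent groups of class at most $c$ is $$\mathcal N_cM(G)=\frac{R\cap\gamma_{c+1}(F)}{[R,\,{}_cF]},$$ where $\gamma_{c+1}(F)$ is the $(c+1)$st term of the lower central series ($\gamma_1(F)=F$), $[R,\,{}_0F]=R$ and $[R,\,{}_{n+1}F]=[[R,\,{}_nF],F]$. Basic commutators on letters $x_1,\dots,x_t$ are the following formal (bracketed) commutators. Fix a total order on the formal commutators in which $x_1<\cdots<x_t$, commutators of smaller weight precede those of larger weight, and commutators of equal weight at least $2$ are ordered arbitrarily (the weight is the number of letters, counted with multiplicity). Every letter is basic, and $[a,b]$ is basic if and only if $a$ and $b$ are basic, $a>b$, and $q\le b$ whenever $a=[p,q]$. To a formal commutator $w$ associate an abelian group $H_w$ by $H_{x_i}=H_i$ and $H_{[a,b]}=H_a\otimes_{\mathbb Z}H_b$, and put $$T(H_1,\dots,H_t)_s=\bigoplus_{w}H_w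 ,$$ the direct sum over all basic commutators $w$ of weight $s$ on $x_1,\dots,x_t$. Then, for every free presentation of $G$ and every such order, $$\mathcal N_cM(H_1\times\cdots\times H_t)\cong T(H_1,\dots,H_t)_{c+1}.$$ -/

import Mathlib

open scoped TensorProduct DirectSum

universe u v

/-- `[R, F, …, F]` with `n` copies of `F`, left-normed: `[R, ₀F] = R` and
`[R, ₙ₊₁F] = [[R, ₙF], F]`. -/
def iteratedCommutator {F : Type v} [Group F] (R : Subgroup F) : ℕ → Subgroup F
  | 0 => R
  | n + 1 => ⁅iteratedCommutator R n, (⊤ : Subgroup F)⁆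

instance iteratedCommutator_normal {F : Type v} [Group F] (R : Subgroup F) [R.Normal] (n : ℕ) :
    (iteratedCommutator R n).Normal := by
  induction n with
  | zero => assumption
  | succ n ih => exact Subgroup.commutator_normal _ _

/-- The numerator `R ∩ γ_{c+1}(F)`, where `R` is the kernel of `π : F → G`. In Mathlib the lower
central series is indexed from `0`, so that `γ_{c+1}(F)` is `(⊤ : Subgroup F).lowerCentralSeries c`. -/
def multiplierNumerator {F : Type v} {G : Type u} [Group F] [Group G] (π : F →* G) (c : ℕ) :
    Subgroup F :=
  π.ker ⊓ (⊤ : Subgroup F).lowerCentralSeries c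

/-- The denominator is contained in the numerator. -/
theorem iteratedCommutator_le_multiplierNumerator {F : Type v} {G : Type u} [Group F] [Group G]
    (π : F →* G) (c : ℕ) : iteratedCommutator π.ker c ≤ multiplierNumerator π c := by
  refine le_inf ?_ ?_
  · induction c with
    | zero => exact le_rfl
    | succ n ih => exact (Subgroup.commutator_le_left _ _).trans ih
  · induction c with
    | zero => exact le_top
    | succ n ih => exact Subgroup.commutator_mono ih le_rfl

/-- The higher Schur multiplicator `(R ∩ γ_{c+1}(F)) / [R, F, …, F]` (`c` copies of `F`) of `G`
with respect to the variety of nilpotent groups of class at most `c`, computed from the free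
presentation `1 → R → F → G → 1` given by a surjection `π` with kernel `R` from a free group. -/
abbrev HigherSchurMultiplicator {F : Type v} {G : Type u} [Group F] [Group G] (π : F →* G)
    (c : ℕ) : Type v :=
  multiplierNumerator π c ⧸ (iteratedCommutator π.ker c).subgroupOf (multiplierNumerator π c)

/-- The orderings of commutators that the definition of basic commutators allows. Formal
commutators on the letters `x_0, …, x_{t-1}` are elements of the free magma, `a * b` standing for
`[a, b]`; the weight is `FreeMagma.length`. The letters have their usual order, commutators of
smaller weight come first, and those of equal weight at least two are ordered arbitrarily. -/
structure IsCommutatorOrder {t : ℕ} (lt : FreeMagma (Fin t) → FreeMagma (Fin t) → Prop) :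
    Prop where
  strictTotal : IsStrictTotalOrder (FreeMagma (Fin t)) lt
  letters : ∀ i j : Fin t, i < j → lt (FreeMagma.of i) (FreeMagma.of j)
  weight : ∀ a b : FreeMagma (Fin t), a.length < b.length → lt a b

/-- Basic commutators in the sense of M. Hall: every letter is basic, and `[a, b]` is basic when
`a` and `b` are basic, `a > b`, and `b ≥ q` whenever `a = [p, q]`. -/
def IsBasicCommutator {t : ℕ} (lt : FreeMagma (Fin t) → FreeMagma (Fin t) → Prop) :
    FreeMagma (Fin t) → Prop
  | .of _ => True
  | .mul a b => IsBasicCommutator lt a ∧ IsBasicCommutator lt b ∧ lt b a ∧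
      ∀ p q : FreeMagma (Fin t), a = p * q → q = b ∨ lt q b

/-- The iterated tensor product over `ℤ` of the abelian groups `H i` (written additively),
bracketed as the formal commutator: the letter `x_i` gives `H i` and `[a, b]` gives the tensor
product of the groups of `a` and `b`. -/
noncomputable def bracketedTensor {t : ℕ} (H : Fin t → Type u) [∀ i, CommGroup (H i)] :
    FreeMagma (Fin t) → ModuleCat.{u} ℤ
  | .of i => ModuleCat.of ℤ (Additive (H i))
  | .mul a b => ModuleCat.of ℤ (bracketedTensor H a ⊗[ℤ] bracketedTensor H b)

/-- `T(H_1, …, H_t)_s`: the direct sum of the bracketed tensor products over all basic commutators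
of weight `s` on `t` letters. -/
abbrev BasicTensorSum {t : ℕ} (lt : FreeMagma (Fin t) → FreeMagma (Fin t) → Prop)
    (H : Fin t → Type u) [∀ i, CommGroup (H i)] (s : ℕ) : Type u :=
  ⨁ w : {w : FreeMagma (Fin t) // IsBasicCommutator lt w ∧ w.length = s}, bracketedTensor H w.1

/-!
Put `G = H_1 × ⋯ × H_t` and `n_i = |H_i|`. By the usual Baer invariance argument
(`nonempty_multiplicator_mulEquiv`) the multiplicator does not depend on the presentation, so let
`F` be free on `x_1, …, x_t` and let `x_i` map to a generator of `H_i`. As `G` is abelian and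
`c ≥ 1`, the numerator is `γ_{c+1}(F)`, and the denominator `[R, F, …, F]` contains `γ_{c+2}(F)`.

Basic commutators of weight `c + 1` generate `γ_{c+1}(F)` modulo `γ_{c+2}(F)`, by collecting
(`basicCommutatorSubgroup_eq_lowerCentralSeries`). Since `x_i ^ n_i ∈ R`, the basic commutator `w`
satisfies `w ^ n_i ∈ [R, F, …, F]` for each of its letters `x_i`, hence `w ^ d ∈ [R, F, …, F]`,
where `d` is the greatest common divisor of these `n_i` (`groupCommutator_pow_mem`). As
`H_w ≅ ℤ/d` (`nonempty_bracketedTensor_equiv`), the multiplicator is a quotient of the direct sum of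
the groups `H_w`, and it remains to see that there are no further relations.

Suppose that a product of powers of basic commutators lies in `[R, F, …, F]`, and fix one of them,
`w`, with its `d`. Over `ℤ/d`, map `x_i` to `1 + y_i X`, where `y_i` is the `i`-th generator of the
free associative algebra if `d ∣ n_i`, and `0` otherwise. Then `n_i y_i = 0`, so that `R` is mapped
to units `1 + O(X²)` and `[R, F, …, F]` to units `1 + O(X^{c+2})`, while a basic commutator of
weight `c + 1` is mapped to `1 + P X^{c+1} + ⋯`, with `P` the corresponding Lie element. So the
relation becomes a linear relation between Lie elements, and the exponent of `w` is divisible by `d`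
because basic commutators are linearly independent in the free associative algebra over any
commutative ring (`linearIndependent_ringCommutator`). This holds since the ordered products of
basic commutators of total weight `n` span the component of degree `n`, and there are at most as
many of them as there are words of length `n`: deleting the brackets is injective on nondecreasing
sequences of basic commutators, a sequence being recovered from its word by collecting the letters
from right to left (`collectWord_flatMap_foliage`).
-/

open scoped commutatorElement

/-! ### Commutator calculus -/

section Groups

variable {G : Type*} [Group G]

/-- The three subgroups lemma modulo a normal subgroup. -/
theorem commutator_commutator_le_of_rotate {H₁ H₂ H₃ N : Subgroup G} [N.Normal]
    (h1 : ⁅⁅H₂, H₃⁆, H₁⁆ ≤ N) (h2 : ⁅⁅H₃, H₁⁆, H₂⁆ ≤ N) : ⁅⁅H₁, H₂⁆, H₃⁆ ≤ N := by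
  have key : ∀ K : Subgroup G, K ≤ N ↔ K.map (QuotientGroup.mk' N) = ⊥ := fun K => by
    rw [Subgroup.map_eq_bot_iff, QuotientGroup.ker_mk']
  rw [key] at h1 h2 ⊢
  simp only [Subgroup.map_commutator] at h1 h2 ⊢
  exact Subgroup.commutator_commutator_eq_bot_of_rotate h1 h2

theorem iteratedCommutator_top (n : ℕ) :
    iteratedCommutator (⊤ : Subgroup G) n = (⊤ : Subgroup G).lowerCentralSeries n := by
  induction n with
  | zero => rfl
  | succ n ih => rw [iteratedCommutator, ih]; rfl

theorem iteratedCommutator_map {K : Type*} [Group K] (f : G →* K) {R : Subgroup G} {S : Subgroup K}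
    (h : R.map f ≤ S) (n : ℕ) : (iteratedCommutator R n).map f ≤ iteratedCommutator S n := by
  induction n with
  | zero => exact h
  | succ n ih =>
    rw [iteratedCommutator, Subgroup.map_commutator]
    exact Subgroup.commutator_mono ih le_top

/-- The three subgroups lemma gives `[[R, ᵢG], γ_{j+1}(G)] ≤ [R, ᵢ₊ⱼ₊₁G]`. -/
theorem iteratedCommutator_commutator_lowerCentralSeries_le (R : Subgroup G) [R.Normal] (i j : ℕ) :
    ⁅iteratedCommutator R i, (⊤ : Subgroup G).lowerCentralSeries j⁆ ≤
      iteratedCommutator R (i + j + 1) := by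
  induction j generalizing i with
  | zero => exact le_rfl
  | succ j ih =>
    rw [Subgroup.commutator_comm, Subgroup.lowerCentralSeries_succ]
    refine commutator_commutator_le_of_rotate ?_ ?_
    · rw [Subgroup.commutator_comm ⊤]
      refine (ih (i + 1)).trans (le_of_eq ?_)
      congr 1; omega
    · exact Subgroup.commutator_mono (ih i) le_rfl

theorem lowerCentralSeries_succ_le_iteratedCommutator {R : Subgroup G}
    (hR : ⁅(⊤ : Subgroup G), ⊤⁆ ≤ R) (n : ℕ) :
    (⊤ : Subgroup G).lowerCentralSeries (n + 1) ≤ iteratedCommutator R n := by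
  induction n with
  | zero => exact hR
  | succ n ih => exact Subgroup.commutator_mono ih le_rfl

/-- The elements that commute with `y` modulo a normal subgroup `N`. -/
def centralizerMod (N : Subgroup G) [N.Normal] (y : G) : Subgroup G :=
  (Subgroup.centralizer {QuotientGroup.mk' N y}).comap (QuotientGroup.mk' N)

theorem mk_commutatorElement_eq_one_iff {N : Subgroup G} [N.Normal] {x y : G} :
    ⁅(x : G ⧸ N), (y : G ⧸ N)⁆ = 1 ↔ ⁅x, y⁆ ∈ N := by
  rw [← QuotientGroup.eq_one_iff]; rfl

theorem mem_centralizerMod {N : Subgroup G} [N.Normal] {x y : G} :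
    x ∈ centralizerMod N y ↔ ⁅x, y⁆ ∈ N := by
  rw [← mk_commutatorElement_eq_one_iff, commutatorElement_eq_one_iff_mul_comm, centralizerMod,
    Subgroup.mem_comap, Subgroup.mem_centralizer_singleton_iff]
  rfl

theorem commutatorElement_mem_comm {N : Subgroup G} {x y : G} : ⁅x, y⁆ ∈ N ↔ ⁅y, x⁆ ∈ N := by
  rw [← commutatorElement_inv, inv_mem_iff]

/-- If `[x, y]` commutes with `x` modulo `N`, then `[x ^ k, y] ≡ [x, y] ^ k` modulo `N`. -/
theorem commutatorElement_pow_mem {N : Subgroup G} [N.Normal] {x y : G} (k : ℕ)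
    (h : ⁅⁅x, y⁆, x⁆ ∈ N) (hk : ⁅x ^ k, y⁆ ∈ N) : ⁅x, y⁆ ^ k ∈ N := by
  have hc : Commute ⁅(x : G ⧸ N), (y : G ⧸ N)⁆ (x : G ⧸ N) := by
    rw [← commutatorElement_eq_one_iff_commute]
    exact (QuotientGroup.eq_one_iff _).2 h
  have e : ∀ k : ℕ, ⁅(x : G ⧸ N) ^ k, (y : G ⧸ N)⁆ = ⁅(x : G ⧸ N), (y : G ⧸ N)⁆ ^ k := by
    intro k
    induction k with
    | zero => simp
    | succ k ih =>
      rw [pow_succ', commutatorElement_mul_left_eq_conj_mul, ih, pow_succ]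
      rw [(hc.symm.pow_right k).eq]; group
  have hk' : ⁅(x : G ⧸ N) ^ k, (y : G ⧸ N)⁆ = 1 := (QuotientGroup.eq_one_iff _).2 hk
  rw [e] at hk'
  exact (QuotientGroup.eq_one_iff _).1 hk'

/-- A form of the Hall–Witt identity: the Jacobi identity modulo a normal subgroup `N` which is
large enough for the occurring commutators to be additive in each entry. -/
theorem commutatorElement_mem_of_hallWitt {N : Subgroup G} [N.Normal] {p q k : G}
    (h1 : ⁅⁅p, k⁆, q⁆ ∈ N) (h1' : ∀ z : G, ⁅⁅z, ⁅p, k⁆⁆, q⁆ ∈ N)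
    (h2 : ⁅⁅q, k⁆, p⁆ ∈ N) (h2' : ∀ z : G, ⁅⁅z, ⁅q, k⁆⁆, p⁆ ∈ N) : ⁅⁅p, q⁆, k⁆ ∈ N := by
  have conj : ∀ {c r : G}, ⁅c, r⁆ ∈ N → (∀ z : G, ⁅⁅z, c⁆, r⁆ ∈ N) →
      ∀ z : G, ⁅z * c * z⁻¹, r⁆ ∈ N := by
    intro c r hc hz z
    have : z * c * z⁻¹ = ⁅z, c⁆ * c := by simp [commutatorElement_def]
    rw [this, ← mem_centralizerMod]
    exact mul_mem (mem_centralizerMod.2 (hz z)) (mem_centralizerMod.2 hc)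
  have inv : ∀ {c r : G}, ⁅c, r⁆ ∈ N → ⁅c, r⁻¹⁆ ∈ N := by
    intro c r h
    rw [commutatorElement_mem_comm, ← mem_centralizerMod] at h ⊢
    exact inv_mem h
  have e1 := conj h1 h1' (k⁻¹ * p⁻¹)
  have e2 := conj h2 h2' q⁻¹
  have t1 : (k⁻¹ * p⁻¹) * ⁅p, k⁆ * (k⁻¹ * p⁻¹)⁻¹ = ⁅k⁻¹, p⁻¹⁆⁻¹ := by
    simp [commutatorElement_def, mul_assoc]
  have t2 : q⁻¹ * ⁅q, k⁆ * q⁻¹⁻¹ = ⁅q⁻¹, k⁆⁻¹ := by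
    simp [commutatorElement_def, mul_assoc]
  rw [t1, ← mem_centralizerMod, inv_mem_iff, mem_centralizerMod] at e1
  rw [t2, ← mem_centralizerMod, inv_mem_iff, mem_centralizerMod] at e2
  replace e2 := inv e2
  have hn : N.Normal := inferInstance
  -- the Hall–Witt identity for `p⁻¹`, `q`, `k`
  have w : ⁅⁅p, q⁆, k⁆ = p *
      ((q * ⁅⁅q⁻¹, k⁆, p⁻¹⁆ * q⁻¹)⁻¹ * (k * ⁅⁅k⁻¹, p⁻¹⁆, q⁆ * k⁻¹)⁻¹) * p⁻¹ := by
    simp only [commutatorElement_def]; group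
  rw [w]
  exact hn.conj_mem _ (mul_mem (inv_mem (hn.conj_mem _ e2 _)) (inv_mem (hn.conj_mem _ e1 _))) _

end Groups

/-! ### Basic commutators generate the lower central factors -/

section HallSpanning

theorem FreeMagma.finite_setOf_length_le {α : Type*} [Finite α] (n : ℕ) :
    {m : FreeMagma α | m.length ≤ n}.Finite := by
  induction n with
  | zero =>
    refine Set.Finite.subset Set.finite_empty fun m hm => ?_
    have := m.length_pos
    simp only [Set.mem_ofPred_eq] at hm
    omega
  | succ n ih =>
    refine ((Set.finite_range (FreeMagma.of : α → FreeMagma α)).union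
      (Set.Finite.image2 (· * ·) ih ih)).subset fun m hm => ?_
    cases m with
    | of i => exact Or.inl ⟨i, rfl⟩
    | mul a b =>
      have ha := a.length_pos
      have hb := b.length_pos
      have hm' : a.length + b.length ≤ n + 1 := hm
      exact Or.inr ⟨a, show a.length ≤ n by omega, b, show b.length ≤ n by omega, rfl⟩

variable {t : ℕ} {lt : FreeMagma (Fin t) → FreeMagma (Fin t) → Prop}

theorem IsCommutatorOrder.length_le (hlt : IsCommutatorOrder lt) {a b : FreeMagma (Fin t)}
    (h : lt a b) : a.length ≤ b.length := by
  have := hlt.strictTotal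
  by_contra! h'
  exact asymm_of lt h (hlt.weight _ _ h')

theorem IsCommutatorOrder.trichotomous (hlt : IsCommutatorOrder lt) (a b : FreeMagma (Fin t)) :
    lt a b ∨ a = b ∨ lt b a := by
  have := hlt.strictTotal
  exact trichotomous_of lt a b

theorem IsCommutatorOrder.trans (hlt : IsCommutatorOrder lt) {a b c : FreeMagma (Fin t)}
    (h : lt a b) (h' : lt b c) : lt a c := by
  have := hlt.strictTotal
  exact trans_of lt h h'

theorem IsCommutatorOrder.irrefl (hlt : IsCommutatorOrder lt) (a : FreeMagma (Fin t)) :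
    ¬ lt a a := by
  have := hlt.strictTotal
  exact irrefl_of lt a

theorem IsCommutatorOrder.wellFounded (hlt : IsCommutatorOrder lt) : WellFounded lt := by
  have := hlt.strictTotal
  refine ⟨fun a => ?_⟩
  have hw : {m : FreeMagma (Fin t) | m.length ≤ a.length}.WellFoundedOn lt :=
    (FreeMagma.finite_setOf_length_le _).wellFoundedOn
  refine hw.induction (P := Acc lt) (show a.length ≤ a.length from le_rfl) fun b hb ih => ?_
  exact ⟨_, fun c hc => ih c ((hlt.length_le hc).trans hb) hc⟩

/-- Induction from large to small commutators, among the commutators of weight at most `n`. -/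
theorem IsCommutatorOrder.reverse_induction (hlt : IsCommutatorOrder lt) (n : ℕ)
    {C : FreeMagma (Fin t) → Prop}
    (h : ∀ k, k.length ≤ n → (∀ k', k'.length ≤ n → lt k k' → C k') → C k)
    {k : FreeMagma (Fin t)} (hk : k.length ≤ n) : C k := by
  have := hlt.strictTotal
  have hw : {m : FreeMagma (Fin t) | m.length ≤ n}.WellFoundedOn (Function.swap lt) :=
    (FreeMagma.finite_setOf_length_le _).wellFoundedOn
  exact hw.induction hk fun b hb ih => h b hb ih

variable {G : Type*} [Group G]

/-- The value in a group of a formal commutator. -/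
def groupCommutator (x : Fin t → G) : FreeMagma (Fin t) → G
  | .of i => x i
  | .mul a b => ⁅groupCommutator x a, groupCommutator x b⁆

theorem groupCommutator_mem_lowerCentralSeries (x : Fin t → G) (m : FreeMagma (Fin t)) {n : ℕ}
    (h : m.length = n + 1) : groupCommutator x m ∈ (⊤ : Subgroup G).lowerCentralSeries n := by
  induction m generalizing n with
  | ih1 i =>
    obtain rfl : n = 0 := by simpa [FreeMagma.length] using h.symm
    trivial
  | ih2 a b iha ihb =>
    obtain ⟨i, hi⟩ := Nat.exists_eq_succ_of_ne_zero a.length_pos.ne'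
    obtain ⟨j, hj⟩ := Nat.exists_eq_succ_of_ne_zero b.length_pos.ne'
    have h' : a.length + b.length = n + 1 := h
    obtain rfl : n = i + j + 1 := by omega
    have := iteratedCommutator_commutator_lowerCentralSeries_le (⊤ : Subgroup G) i j
    rw [iteratedCommutator_top, iteratedCommutator_top] at this
    exact this (Subgroup.commutator_mem_commutator (iha hi) (ihb hj))

theorem commutatorElement_mem_lowerCentralSeries {x y : G} {i j n : ℕ}
    (hx : x ∈ (⊤ : Subgroup G).lowerCentralSeries i)
    (hy : y ∈ (⊤ : Subgroup G).lowerCentralSeries j) (hn : n ≤ i + j + 1) :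
    ⁅x, y⁆ ∈ (⊤ : Subgroup G).lowerCentralSeries n := by
  have := iteratedCommutator_commutator_lowerCentralSeries_le (⊤ : Subgroup G) i j
  rw [iteratedCommutator_top, iteratedCommutator_top] at this
  exact Subgroup.lowerCentralSeries_antitone _ hn
    (this (Subgroup.commutator_mem_commutator hx hy))

/-- The subgroup generated by the basic commutators of weight `n + 1` and by `γ_{n+2}(G)`. -/
def basicCommutatorSubgroup (lt : FreeMagma (Fin t) → FreeMagma (Fin t) → Prop) (x : Fin t → G)
    (n : ℕ) : Subgroup G :=
  Subgroup.closure (groupCommutator x '' {w | IsBasicCommutator lt w ∧ w.length = n + 1}) ⊔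
    (⊤ : Subgroup G).lowerCentralSeries (n + 1)

theorem lowerCentralSeries_succ_le_basicCommutatorSubgroup (x : Fin t → G) (n : ℕ) :
    (⊤ : Subgroup G).lowerCentralSeries (n + 1) ≤ basicCommutatorSubgroup lt x n :=
  le_sup_right

theorem groupCommutator_mem_basicCommutatorSubgroup (x : Fin t → G) {n : ℕ}
    {w : FreeMagma (Fin t)} (hw : IsBasicCommutator lt w) (h : w.length = n + 1) :
    groupCommutator x w ∈ basicCommutatorSubgroup lt x n :=
  Subgroup.mem_sup_left (Subgroup.subset_closure ⟨w, ⟨hw, h⟩, rfl⟩)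

theorem basicCommutatorSubgroup_le_iff {x : Fin t → G} {n : ℕ} {S : Subgroup G} :
    basicCommutatorSubgroup lt x n ≤ S ↔
      (∀ w, IsBasicCommutator lt w → w.length = n + 1 → groupCommutator x w ∈ S) ∧
        (⊤ : Subgroup G).lowerCentralSeries (n + 1) ≤ S := by
  rw [basicCommutatorSubgroup, sup_le_iff, Subgroup.closure_le]
  refine and_congr_left fun _ => ⟨fun h w hw hn => h ⟨w, ⟨hw, hn⟩, rfl⟩, ?_⟩
  rintro h _ ⟨w, ⟨hw, hn⟩, rfl⟩
  exact h w hw hn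

theorem basicCommutatorSubgroup_le_lowerCentralSeries (x : Fin t → G) (n : ℕ) :
    basicCommutatorSubgroup lt x n ≤ (⊤ : Subgroup G).lowerCentralSeries n :=
  basicCommutatorSubgroup_le_iff.2
    ⟨fun w _ h => groupCommutator_mem_lowerCentralSeries x w h,
      Subgroup.lowerCentralSeries_antitone _ n.le_succ⟩

instance basicCommutatorSubgroup_normal (x : Fin t → G) (n : ℕ) :
    (basicCommutatorSubgroup lt x n).Normal := by
  rw [← Subgroup.commutator_top_right_le_iff]
  exact (Subgroup.commutator_mono (basicCommutatorSubgroup_le_lowerCentralSeries x n) le_rfl).trans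
    (lowerCentralSeries_succ_le_basicCommutatorSubgroup x n)

/-- To bound `[z, y]` for all `z` in `basicCommutatorSubgroup lt x i`, it is enough to take basic
commutators for `z`, because the commutator is additive in `z` modulo `γ_{n+2}(G)`. -/
theorem commutatorElement_mem_of_mem_basicCommutatorSubgroup {x : Fin t → G} {i j n : ℕ} {y z : G}
    (hz : z ∈ basicCommutatorSubgroup lt x i) (hy : y ∈ (⊤ : Subgroup G).lowerCentralSeries j)
    (hn : n = i + j + 1)
    (h : ∀ w, IsBasicCommutator lt w → w.length = i + 1 →
      ⁅groupCommutator x w, y⁆ ∈ basicCommutatorSubgroup lt x n) :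
    ⁅z, y⁆ ∈ basicCommutatorSubgroup lt x n := by
  rw [← mem_centralizerMod]
  refine (basicCommutatorSubgroup_le_iff.2 ⟨fun w hw hi => ?_, fun u hu => ?_⟩ :
    basicCommutatorSubgroup lt x i ≤ _) hz
  · exact mem_centralizerMod.2 (h w hw hi)
  · exact mem_centralizerMod.2 (lowerCentralSeries_succ_le_basicCommutatorSubgroup x n
      (commutatorElement_mem_lowerCentralSeries hu hy (by omega)))

/-- The collecting argument: modulo `γ_{n+2}(G)`, the commutator of two basic commutators of total
weight `n + 1` is a product of basic commutators. If `[[p, q], k]` is not basic although `[p, q]`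
and `k` are, then `k < q < p`, and the Jacobi identity expresses it by commutators of basic
commutators which are all larger than `k`. -/
theorem commutatorElement_mem_basicCommutatorSubgroup (hlt : IsCommutatorOrder lt) (x : Fin t → G)
    (n : ℕ) {a b : FreeMagma (Fin t)} (ha : IsBasicCommutator lt a) (hb : IsBasicCommutator lt b)
    (hab : a.length + b.length = n + 1) :
    ⁅groupCommutator x a, groupCommutator x b⁆ ∈ basicCommutatorSubgroup lt x n := by
  induction n using Nat.strong_induction_on generalizing a b with
  | _ n IH =>
  have main : ∀ {k : FreeMagma (Fin t)}, k.length ≤ n + 1 → IsBasicCommutator lt k →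
      ∀ a, IsBasicCommutator lt a → lt k a → a.length + k.length = n + 1 →
      ⁅groupCommutator x a, groupCommutator x k⁆ ∈ basicCommutatorSubgroup lt x n := by
    intro k hk
    refine hlt.reverse_induction (n + 1) (C := fun k => IsBasicCommutator lt k →
      ∀ a, IsBasicCommutator lt a → lt k a → a.length + k.length = n + 1 →
      ⁅groupCommutator x a, groupCommutator x k⁆ ∈ basicCommutatorSubgroup lt x n) ?_ hk
    clear hk k
    intro k _ ihk hkb a hab hka hl
    -- the entries of a commutator may be exchanged, so the induction hypothesis covers all pairs of
    -- basic commutators larger than `k`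
    have pair : ∀ a b, IsBasicCommutator lt a → IsBasicCommutator lt b → lt k a → lt k b →
        a.length + b.length = n + 1 →
        ⁅groupCommutator x a, groupCommutator x b⁆ ∈ basicCommutatorSubgroup lt x n := by
      intro a b ha hb hka hkb hl
      have := a.length_pos
      have := b.length_pos
      rcases hlt.trichotomous a b with h | rfl | h
      · exact commutatorElement_mem_comm.1 (ihk a (by omega) hka ha b hb h (by omega))
      · rw [commutatorElement_self]; exact one_mem _
      · exact ihk b (by omega) hkb hb a ha h hl
    cases a with
    | of i =>
      exact groupCommutator_mem_basicCommutatorSubgroup x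
        (w := FreeMagma.of i * k) ⟨trivial, hkb, hka, fun p q h => by cases h⟩ hl
    | mul p q =>
      obtain ⟨hp, hq, hqp, -⟩ := id hab
      by_cases hqk : q = k ∨ lt q k
      -- `[[p, q], k]` is itself basic
      · refine groupCommutator_mem_basicCommutatorSubgroup x
          (w := FreeMagma.mul p q * k) ⟨hab, hkb, hka, fun p' q' h => ?_⟩ hl
        cases h
        exact hqk
      · have hkq : lt k q := by
          rcases hlt.trichotomous q k with h | h | h
          · exact absurd (Or.inr h) hqk
          · exact absurd (Or.inl h) hqk
          · exact h
        have hkp : lt k p := hlt.trans hkq hqp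
        have hl' : p.length + q.length + k.length = n + 1 := hl
        obtain ⟨i, hi⟩ := Nat.exists_eq_succ_of_ne_zero p.length_pos.ne'
        obtain ⟨j, hj⟩ := Nat.exists_eq_succ_of_ne_zero q.length_pos.ne'
        obtain ⟨l, hl''⟩ := Nat.exists_eq_succ_of_ne_zero k.length_pos.ne'
        have Pm := groupCommutator_mem_lowerCentralSeries x p hi
        have Qm := groupCommutator_mem_lowerCentralSeries x q hj
        have Km := groupCommutator_mem_lowerCentralSeries x k hl''
        have hsmall : ∀ {z c r : G} {i' j' : ℕ},
            c ∈ (⊤ : Subgroup G).lowerCentralSeries i' →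
            r ∈ (⊤ : Subgroup G).lowerCentralSeries j' → n = i' + j' + 1 →
            ⁅⁅z, c⁆, r⁆ ∈ basicCommutatorSubgroup lt x n := by
          intro z c r i' j' hc hr hn
          refine lowerCentralSeries_succ_le_basicCommutatorSubgroup x n ?_
          refine commutatorElement_mem_lowerCentralSeries (i := i' + 1) ?_ hr (by omega)
          exact commutatorElement_mem_comm.1
            (commutatorElement_mem_lowerCentralSeries (j := 0) hc trivial le_rfl)
        have PK := IH (i + l + 1) (by omega) hp hkb (by omega)
        have QK := IH (j + l + 1) (by omega) hq hkb (by omega)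
        -- by induction on the weight, `[p, k]` and `[q, k]` are products of basic commutators, which
        -- are heavier than `k`; so only pairs of commutators larger than `k` remain
        refine commutatorElement_mem_of_hallWitt ?_ ?_ ?_ ?_
        · refine commutatorElement_mem_of_mem_basicCommutatorSubgroup PK Qm (by omega) ?_
          intro w hw hwl
          exact pair w q hw hq (hlt.weight _ _ (by omega)) hkq (by omega)
        · exact fun z => hsmall (i' := i + l + 1) (j' := j)
            (commutatorElement_mem_lowerCentralSeries Pm Km le_rfl) Qm (by omega)
        · refine commutatorElement_mem_of_mem_basicCommutatorSubgroup QK Pm (by omega) ?_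
          intro w hw hwl
          exact pair w p hw hp (hlt.weight _ _ (by omega)) hkp (by omega)
        · exact fun z => hsmall (i' := j + l + 1) (j' := i)
            (commutatorElement_mem_lowerCentralSeries Qm Km le_rfl) Pm (by omega)
  rcases hlt.trichotomous a b with h | rfl | h
  · exact commutatorElement_mem_comm.1 (main (by omega) ha b hb h (by omega))
  · rw [commutatorElement_self]; exact one_mem _
  · exact main (by omega) hb a ha h hab

/-- Basic commutators of weight `n + 1` generate `γ_{n+1}(G)` modulo `γ_{n+2}(G)`. -/
theorem basicCommutatorSubgroup_eq_lowerCentralSeries (hlt : IsCommutatorOrder lt) {x : Fin t → G}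
    (hx : Subgroup.closure (Set.range x) = ⊤) (n : ℕ) :
    basicCommutatorSubgroup lt x n = (⊤ : Subgroup G).lowerCentralSeries n := by
  refine le_antisymm (basicCommutatorSubgroup_le_lowerCentralSeries x n) ?_
  induction n with
  | zero =>
    rw [Subgroup.lowerCentralSeries_zero, ← hx, Subgroup.closure_le]
    rintro _ ⟨i, rfl⟩
    exact groupCommutator_mem_basicCommutatorSubgroup x (w := FreeMagma.of i) trivial rfl
  | succ n ih =>
    rw [Subgroup.lowerCentralSeries_succ, Subgroup.commutator_le]
    intro z hz g _
    rw [commutatorElement_mem_comm, ← mem_centralizerMod]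
    suffices h : Subgroup.closure (Set.range x) ≤
        centralizerMod (basicCommutatorSubgroup lt x (n + 1)) z from h (hx ▸ Subgroup.mem_top g)
    rw [Subgroup.closure_le]
    rintro _ ⟨i, rfl⟩
    refine mem_centralizerMod.2 (commutatorElement_mem_comm.1 ?_)
    refine commutatorElement_mem_of_mem_basicCommutatorSubgroup (ih hz) (j := 0) trivial rfl ?_
    intro w hw hwl
    exact commutatorElement_mem_basicCommutatorSubgroup hlt x (n + 1) hw
      (b := FreeMagma.of i) trivial (by simp [hwl, FreeMagma.length])

/-- The collecting argument for the formal commutator `[a, b]` of two basic commutators. -/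
theorem groupCommutator_mem_basicCommutatorSubgroup_of_mul (hlt : IsCommutatorOrder lt)
    (x : Fin t → G) {a b : FreeMagma (Fin t)} (ha : IsBasicCommutator lt a)
    (hb : IsBasicCommutator lt b) {n : ℕ} (h : (a * b).length = n + 1) :
    groupCommutator x (a * b) ∈ basicCommutatorSubgroup lt x n :=
  commutatorElement_mem_basicCommutatorSubgroup hlt x n ha hb h

/-- The greatest common divisor of the numbers `N i`, over the letters `x_i` of a formal commutator.
For `N i = |H i|` it is the order of the cyclic group `bracketedTensor H m`. -/
def gcdCard (N : Fin t → ℕ) : FreeMagma (Fin t) → ℕ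
  | .of i => N i
  | .mul a b => Nat.gcd (gcdCard N a) (gcdCard N b)

/-- If `x i ^ N i ∈ R ⊇ [G, G]` for all `i`, then the power of a formal commutator of weight
`n + 1` to the greatest common divisor of the numbers `N i` of its letters lies in `[R, ₙG]`. -/
theorem groupCommutator_pow_mem (R : Subgroup G) [R.Normal] (hR : ⁅(⊤ : Subgroup G), ⊤⁆ ≤ R)
    {x : Fin t → G} {N : Fin t → ℕ} (hx : ∀ i, x i ^ N i ∈ R) (m : FreeMagma (Fin t)) {n : ℕ}
    (h : m.length = n + 1) : groupCommutator x m ^ gcdCard N m ∈ iteratedCommutator R n := by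
  induction m generalizing n with
  | ih1 i =>
    obtain rfl : n = 0 := by simpa [FreeMagma.length] using h.symm
    exact hx i
  | ih2 a b iha ihb =>
    obtain ⟨i, hi⟩ := Nat.exists_eq_succ_of_ne_zero a.length_pos.ne'
    obtain ⟨j, hj⟩ := Nat.exists_eq_succ_of_ne_zero b.length_pos.ne'
    have h' : a.length + b.length = n + 1 := h
    obtain rfl : n = i + j + 1 := by omega
    have Am := groupCommutator_mem_lowerCentralSeries x a hi
    have Bm := groupCommutator_mem_lowerCentralSeries x b hj
    -- `[a ^ k, b] ≡ [a, b] ^ k` modulo `γ_{i+j+3}`, which lies in `[R, ᵢ₊ⱼ₊₁G]`; likewise for `b`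
    have pa : ⁅groupCommutator x a, groupCommutator x b⁆ ^ gcdCard N a ∈
        iteratedCommutator R (i + j + 1) := by
      refine commutatorElement_pow_mem _ (lowerCentralSeries_succ_le_iteratedCommutator hR _ ?_) ?_
      · exact commutatorElement_mem_lowerCentralSeries
          (commutatorElement_mem_lowerCentralSeries Am Bm le_rfl) Am (by omega)
      · exact iteratedCommutator_commutator_lowerCentralSeries_le R i j
          (Subgroup.commutator_mem_commutator (iha hi) Bm)
    have pb : ⁅groupCommutator x a, groupCommutator x b⁆ ^ gcdCard N b ∈
        iteratedCommutator R (i + j + 1) := by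
      rw [← inv_mem_iff, ← inv_pow, commutatorElement_inv]
      refine commutatorElement_pow_mem _ (lowerCentralSeries_succ_le_iteratedCommutator hR _ ?_) ?_
      · exact commutatorElement_mem_lowerCentralSeries
          (commutatorElement_mem_lowerCentralSeries Bm Am le_rfl) Bm (by omega)
      · rw [show i + j + 1 = j + i + 1 by omega]
        exact iteratedCommutator_commutator_lowerCentralSeries_le R j i
          (Subgroup.commutator_mem_commutator (ihb hj) Am)
    change ⁅groupCommutator x a, groupCommutator x b⁆ ^ (gcdCard N a).gcd (gcdCard N b) ∈ _
    rw [← zpow_natCast, Nat.gcd_eq_gcd_ab, zpow_add, zpow_mul, zpow_mul, zpow_natCast,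
      zpow_natCast]
    exact mul_mem (zpow_mem pa _) (zpow_mem pb _)

end HallSpanning

/-! ### The Magnus representation -/

section Magnus

open PowerSeries

variable {A : Type*} [Ring A]

/-- The unit `u` of `A⟦X⟧` is of the form `1 + a Xⁿ + ⋯`, where `a = 0` is allowed. -/
def HasLeadingTerm (u : A⟦X⟧ˣ) (n : ℕ) (a : A) : Prop :=
  ∃ f : A⟦X⟧, (u : A⟦X⟧) = 1 + X ^ n * f ∧ constantCoeff f = a

namespace HasLeadingTerm

variable {u v : A⟦X⟧ˣ} {m n : ℕ} {a b : A}

theorem one (n : ℕ) : HasLeadingTerm (1 : A⟦X⟧ˣ) n 0 :=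
  ⟨0, by simp, by simp⟩

theorem constantCoeff_eq (hu : HasLeadingTerm u n a) (hn : n ≠ 0) :
    constantCoeff (u : A⟦X⟧) = 1 := by
  obtain ⟨f, hf, -⟩ := hu
  rw [hf]
  simp [hn]

theorem constantCoeff_inv (hu : HasLeadingTerm u n a) (hn : n ≠ 0) :
    constantCoeff ((u⁻¹ : A⟦X⟧ˣ) : A⟦X⟧) = 1 := by
  have h := congrArg constantCoeff u.mul_inv
  rwa [map_mul, hu.constantCoeff_eq hn, one_mul, map_one] at h

theorem unique (hu : HasLeadingTerm u n a) (hu' : HasLeadingTerm u n b) : a = b := by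
  obtain ⟨f, hf, rfl⟩ := hu
  obtain ⟨g, hg, rfl⟩ := hu'
  rw [hf, add_right_inj] at hg
  have := congrArg (coeff (0 + n)) hg
  simpa only [coeff_X_pow_mul, coeff_zero_eq_constantCoeff_apply] using this

theorem mul (hu : HasLeadingTerm u n a) (hv : HasLeadingTerm v n b) (hn : n ≠ 0) :
    HasLeadingTerm (u * v) n (a + b) := by
  have hv1 := hv.constantCoeff_eq hn
  obtain ⟨f, hf, rfl⟩ := hu
  obtain ⟨g, hg, rfl⟩ := hv
  refine ⟨f * v + g, ?_, ?_⟩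
  · rw [Units.val_mul, hf]
    nth_rw 2 [hg]
    rw [add_mul, one_mul, mul_add, mul_assoc]
    nth_rw 1 [hg]
    rw [hg]
    abel
  · rw [map_add, map_mul, hv1, mul_one]

theorem inv (hu : HasLeadingTerm u n a) (hn : n ≠ 0) : HasLeadingTerm u⁻¹ n (-a) := by
  have h1 := hu.constantCoeff_inv hn
  obtain ⟨f, hf, rfl⟩ := hu
  refine ⟨-(f * (u⁻¹ : A⟦X⟧ˣ)), ?_, by simp [h1]⟩
  have h := u.mul_inv
  rw [hf, add_mul, one_mul] at h
  rw [mul_neg, ← mul_assoc, ← sub_eq_add_neg, eq_sub_iff_add_eq]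
  exact h

theorem succ (hu : HasLeadingTerm u (n + 1) a) : HasLeadingTerm u n 0 := by
  obtain ⟨f, hf, rfl⟩ := hu
  exact ⟨X * f, by rw [hf, pow_succ, mul_assoc], by simp⟩

theorem exists_succ (h : HasLeadingTerm u n 0) : ∃ a, HasLeadingTerm u (n + 1) a := by
  obtain ⟨f, hf, hf0⟩ := h
  obtain ⟨f', rfl⟩ := X_dvd_iff.2 hf0
  exact ⟨_, f', by rw [hf, pow_succ, mul_assoc], rfl⟩

/-- The commutator of `1 + a Xᵐ + ⋯` and `1 + b Xⁿ + ⋯` is `1 + (a b - b a) Xᵐ⁺ⁿ + ⋯`, because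
`[u, v] - 1 = (u v - v u) u⁻¹ v⁻¹` and `X` is central. -/
theorem commutatorElement (hu : HasLeadingTerm u m a) (hv : HasLeadingTerm v n b) (hm : m ≠ 0)
    (hn : n ≠ 0) : HasLeadingTerm ⁅u, v⁆ (m + n) (a * b - b * a) := by
  have hu1 := hu.constantCoeff_inv hm
  have hv1 := hv.constantCoeff_inv hn
  obtain ⟨f, hf, rfl⟩ := hu
  obtain ⟨g, hg, rfl⟩ := hv
  refine ⟨(f * g - g * f) * ((u⁻¹ : A⟦X⟧ˣ) * (v⁻¹ : A⟦X⟧ˣ)), ?_, by simp [hu1, hv1]⟩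
  have e1 : X ^ m * f * (X ^ n * g) = X ^ (m + n) * (f * g) := by
    rw [mul_assoc, ← mul_assoc f, (commute_X_pow f n).eq, pow_add]
    simp only [mul_assoc]
  have e2 : X ^ n * g * (X ^ m * f) = X ^ (m + n) * (g * f) := by
    rw [mul_assoc, ← mul_assoc g, (commute_X_pow g m).eq, add_comm, pow_add]
    simp only [mul_assoc]
  have key : (u : A⟦X⟧) * (v : A⟦X⟧) = (v : A⟦X⟧) * (u : A⟦X⟧) + X ^ (m + n) * (f * g - g * f) := by
    rw [mul_sub, ← e1, ← e2, hf, hg]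
    noncomm_ring
  have huv : (v : A⟦X⟧) * (u : A⟦X⟧) * ((u⁻¹ : A⟦X⟧ˣ) * (v⁻¹ : A⟦X⟧ˣ)) = 1 := by
    rw [mul_assoc, ← mul_assoc (u : A⟦X⟧), Units.mul_inv, one_mul, Units.mul_inv]
  rw [commutatorElement_def, mul_assoc (u * v), Units.val_mul, Units.val_mul, Units.val_mul, key,
    add_mul, huv, mul_assoc]

end HasLeadingTerm

/-- The units `1 + a Xⁿ⁺¹ + ⋯` with `a ∈ V`. -/
def leadingTermSubgroup (n : ℕ) (V : AddSubgroup A) : Subgroup A⟦X⟧ˣ where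
  carrier := {u | ∃ a ∈ V, HasLeadingTerm u (n + 1) a}
  one_mem' := ⟨0, V.zero_mem, .one _⟩
  mul_mem' := by
    rintro u v ⟨a, ha, hu⟩ ⟨b, hb, hv⟩
    exact ⟨a + b, V.add_mem ha hb, hu.mul hv n.succ_ne_zero⟩
  inv_mem' := by
    rintro u ⟨a, ha, hu⟩
    exact ⟨-a, V.neg_mem ha, hu.inv n.succ_ne_zero⟩

/-- The leading coefficient `1 + a Xⁿ⁺¹ + ⋯ ↦ a`. -/
noncomputable def leadingCoeffHom (n : ℕ) :
    leadingTermSubgroup n (⊤ : AddSubgroup A) →* Multiplicative A where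
  toFun u := Multiplicative.ofAdd u.2.choose
  map_one' := congrArg Multiplicative.ofAdd
    ((1 : leadingTermSubgroup n (⊤ : AddSubgroup A)).2.choose_spec.2.unique (.one _))
  map_mul' u v := congrArg Multiplicative.ofAdd ((u * v).2.choose_spec.2.unique
    (u.2.choose_spec.2.mul v.2.choose_spec.2 n.succ_ne_zero))

theorem leadingCoeffHom_eq {n : ℕ} {u : leadingTermSubgroup n (⊤ : AddSubgroup A)} {a : A}
    (h : HasLeadingTerm (u : A⟦X⟧ˣ) (n + 1) a) : leadingCoeffHom n u = Multiplicative.ofAdd a :=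
  congrArg Multiplicative.ofAdd (u.2.choose_spec.2.unique h)

/-- The value in an associative ring of a formal commutator, `[a, b]` being `a b - b a`. -/
def ringCommutator {t : ℕ} (y : Fin t → A) : FreeMagma (Fin t) → A
  | .of i => y i
  | .mul a b =>
    ringCommutator y a * ringCommutator y b - ringCommutator y b * ringCommutator y a

theorem map_groupCommutator {G K : Type*} [Group G] [Group K] {t : ℕ} (f : G →* K) (x : Fin t → G)
    (m : FreeMagma (Fin t)) : f (groupCommutator x m) = groupCommutator (f ∘ x) m := by
  induction m with
  | ih1 i => rfl
  | ih2 a b iha ihb =>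
    change f ⁅groupCommutator x a, groupCommutator x b⁆ = ⁅_, _⁆
    rw [map_commutatorElement, iha, ihb]

theorem hasLeadingTerm_groupCommutator {t : ℕ} {x : Fin t → A⟦X⟧ˣ} {y : Fin t → A}
    (h : ∀ i, HasLeadingTerm (x i) 1 (y i)) (m : FreeMagma (Fin t)) :
    HasLeadingTerm (groupCommutator x m) m.length (ringCommutator y m) := by
  induction m with
  | ih1 i => exact h i
  | ih2 a b iha ihb =>
    exact iha.commutatorElement ihb a.length_pos.ne' b.length_pos.ne'

/-- The unit `1 + a X`. -/
noncomputable def oneAddMulX (a : A) : A⟦X⟧ˣ :=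
  ⟨1 + X ^ 1 * C a, invOfUnit _ 1, mul_invOfUnit _ _ (by simp), invOfUnit_mul _ _ (by simp)⟩

theorem hasLeadingTerm_oneAddMulX (a : A) : HasLeadingTerm (oneAddMulX a) 1 a :=
  ⟨C a, rfl, by simp⟩

/-- The Magnus representation `x_i ↦ 1 + y_i X` of a free group. The coefficient ring `A` is not
commutative, and the central variable `X` keeps track of the degree, so that no completion of `A`
is needed. -/
noncomputable def magnus {t : ℕ} (y : Fin t → A) : FreeGroup (Fin t) →* A⟦X⟧ˣ :=
  FreeGroup.lift fun i => oneAddMulX (y i)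

theorem hasLeadingTerm_magnus_groupCommutator {t : ℕ} (y : Fin t → A) (m : FreeMagma (Fin t)) :
    HasLeadingTerm (magnus y (groupCommutator FreeGroup.of m)) m.length (ringCommutator y m) := by
  rw [map_groupCommutator]
  refine hasLeadingTerm_groupCommutator (fun i => ?_) m
  simpa [magnus] using hasLeadingTerm_oneAddMulX (y i)

theorem exists_hasLeadingTerm_magnus {t : ℕ} (y : Fin t → A) (g : FreeGroup (Fin t)) :
    ∃ a, HasLeadingTerm (magnus y g) 1 a := by
  have h : Subgroup.closure (Set.range (FreeGroup.of : Fin t → _)) ≤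
      (leadingTermSubgroup 0 (⊤ : AddSubgroup A)).comap (magnus y) := by
    rw [Subgroup.closure_le]
    rintro _ ⟨i, rfl⟩
    exact ⟨y i, trivial, hasLeadingTerm_magnus_groupCommutator y (.of i)⟩
  rw [FreeGroup.closure_range_of] at h
  obtain ⟨a, -, ha⟩ := h (Subgroup.mem_top g)
  exact ⟨a, ha⟩

/-- Each commutator with the whole group raises by one the degree from which on the elements of `R`
differ from `1`. -/
theorem exists_hasLeadingTerm_magnus_of_mem_iteratedCommutator {t : ℕ} (y : Fin t → A)
    {R : Subgroup (FreeGroup (Fin t))} {k : ℕ}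
    (hR : ∀ g ∈ R, ∃ a, HasLeadingTerm (magnus y g) (k + 1) a) {n : ℕ} {g : FreeGroup (Fin t)}
    (hg : g ∈ iteratedCommutator R n) : ∃ a, HasLeadingTerm (magnus y g) (k + n + 1) a := by
  induction n generalizing g with
  | zero => exact hR g hg
  | succ n ih =>
    have h : iteratedCommutator R (n + 1) ≤
        (leadingTermSubgroup (k + n + 1) (⊤ : AddSubgroup A)).comap (magnus y) := by
      rw [iteratedCommutator, Subgroup.commutator_le]
      intro a ha b _
      obtain ⟨a', ha'⟩ := ih ha
      obtain ⟨b', hb'⟩ := exists_hasLeadingTerm_magnus y b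
      refine ⟨a' * b' - b' * a', trivial, ?_⟩
      rw [map_commutatorElement]
      exact ha'.commutatorElement hb' (Nat.succ_ne_zero _) one_ne_zero
    obtain ⟨a, -, ha⟩ := h hg
    exact ⟨a, ha⟩

theorem exists_hasLeadingTerm_magnus_of_mem_lowerCentralSeries {t : ℕ} (y : Fin t → A) {n : ℕ}
    {g : FreeGroup (Fin t)} (hg : g ∈ (⊤ : Subgroup (FreeGroup (Fin t))).lowerCentralSeries n) :
    ∃ a, HasLeadingTerm (magnus y g) (n + 1) a := by
  rw [← iteratedCommutator_top] at hg
  simpa using exists_hasLeadingTerm_magnus_of_mem_iteratedCommutator y (k := 0)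
    (fun g _ => exists_hasLeadingTerm_magnus y g) hg

/-- The collecting argument in an associative algebra, read off from the one in the free group by
means of the Magnus representation. -/
theorem ringCommutator_mul_mem_span {k : Type*} [CommRing k] [Algebra k A] {t : ℕ}
    {lt : FreeMagma (Fin t) → FreeMagma (Fin t) → Prop} (hlt : IsCommutatorOrder lt)
    (y : Fin t → A) {a b : FreeMagma (Fin t)} (ha : IsBasicCommutator lt a)
    (hb : IsBasicCommutator lt b) : ringCommutator y a * ringCommutator y b -
      ringCommutator y b * ringCommutator y a ∈
      Submodule.span k (ringCommutator y ''
        {w | IsBasicCommutator lt w ∧ w.length = a.length + b.length}) := by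
  set V := Submodule.span k (ringCommutator y ''
        {w | IsBasicCommutator lt w ∧ w.length = a.length + b.length})
  obtain ⟨n, hn⟩ := Nat.exists_eq_succ_of_ne_zero (a * b).length_pos.ne'
  have hn' : a.length + b.length = n + 1 := hn
  have h : basicCommutatorSubgroup lt (FreeGroup.of : Fin t → _) n ≤
      (leadingTermSubgroup n V.toAddSubgroup).comap (magnus y) := by
    refine basicCommutatorSubgroup_le_iff.2 ⟨fun w hw hwl => ?_, fun g hg => ?_⟩
    · refine ⟨_, Submodule.subset_span ⟨w, ⟨hw, hwl.trans hn'.symm⟩, rfl⟩, ?_⟩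
      exact hwl ▸ hasLeadingTerm_magnus_groupCommutator y w
    -- elements of `γ_{n+2}` have trivial coefficient in degree `n + 1`
    · obtain ⟨a, ha⟩ := exists_hasLeadingTerm_magnus_of_mem_lowerCentralSeries y hg
      exact ⟨0, zero_mem _, ha.succ⟩
  obtain ⟨c, hc, hc'⟩ := h (groupCommutator_mem_basicCommutatorSubgroup_of_mul hlt
    FreeGroup.of ha hb hn)
  rw [← Nat.succ_eq_add_one, ← hn] at hc'
  rw [hc'.unique (hasLeadingTerm_magnus_groupCommutator y (a * b))] at hc
  exact hc

end Magnus

/-! ### Ordered products of basic commutators in the free associative algebra -/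

section OrderedProducts

variable {t : ℕ} {lt : FreeMagma (Fin t) → FreeMagma (Fin t) → Prop}

/-- Nondecreasing sequences of basic commutators. -/
def IsOrderedBasic (lt : FreeMagma (Fin t) → FreeMagma (Fin t) → Prop)
    (l : List (FreeMagma (Fin t))) : Prop :=
  (∀ w ∈ l, IsBasicCommutator lt w) ∧ l.Pairwise fun a b => ¬ lt b a

theorem isOrderedBasic_cons {a : FreeMagma (Fin t)} {l : List (FreeMagma (Fin t))} :
    IsOrderedBasic lt (a :: l) ↔
      IsBasicCommutator lt a ∧ (∀ c ∈ l, ¬ lt c a) ∧ IsOrderedBasic lt l := by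
  simp only [IsOrderedBasic, List.mem_cons, forall_eq_or_imp, List.pairwise_cons]
  tauto

theorem IsOrderedBasic.cons_cons (hlt : IsCommutatorOrder lt) {a b : FreeMagma (Fin t)}
    {l : List (FreeMagma (Fin t))} (h : IsOrderedBasic lt (b :: l)) (ha : IsBasicCommutator lt a)
    (hab : ¬ lt b a) : IsOrderedBasic lt (a :: b :: l) := by
  refine isOrderedBasic_cons.2 ⟨ha, fun c hc hca => ?_, h⟩
  rcases List.mem_cons.1 hc with rfl | hc
  · exact hab hca
  · have hcb := (isOrderedBasic_cons.1 h).2.1 c hc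
    rcases hlt.trichotomous b c with hbc | rfl | hbc
    · exact hab (hlt.trans hbc hca)
    · exact hab hca
    · exact hcb hbc

section Spanning

variable {k A : Type*} [CommRing k] [Ring A] [Algebra k A]

/-- The span of the products of at most `r` basic commutators in nondecreasing order, of total
weight `n`. -/
def orderedProductSpan (k : Type*) [CommRing k] [Algebra k A]
    (lt : FreeMagma (Fin t) → FreeMagma (Fin t) → Prop) (y : Fin t → A) (n r : ℕ) :
    Submodule k A :=
  Submodule.span k {x | ∃ l, IsOrderedBasic lt l ∧ (l.map FreeMagma.length).sum = n ∧
    l.length ≤ r ∧ (l.map (ringCommutator y)).prod = x}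

theorem orderedProductSpan_mono {y : Fin t → A} {n r s : ℕ} (h : r ≤ s) :
    orderedProductSpan k lt y n r ≤ orderedProductSpan k lt y n s := by
  refine Submodule.span_mono ?_
  rintro x ⟨l, h1, h2, h3, h4⟩
  exact ⟨l, h1, h2, h3.trans h, h4⟩

theorem mul_mem_of_mem_span {S : Set A} {W : Submodule k A} {x z : A}
    (hx : x ∈ Submodule.span k S) (h : ∀ u ∈ S, u * z ∈ W) : x * z ∈ W := by
  have : Submodule.span k S ≤ W.comap (LinearMap.mulRight k z) := Submodule.span_le.2 h
  exact this hx

theorem mul_mem_of_mem_span_right {S : Set A} {W : Submodule k A} {x z : A}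
    (hx : x ∈ Submodule.span k S) (h : ∀ u ∈ S, z * u ∈ W) : z * x ∈ W := by
  have : Submodule.span k S ≤ W.comap (LinearMap.mulLeft k z) := Submodule.span_le.2 h
  exact this hx

/-- Inserting a basic commutator into an ordered product. If `a` has to move past a smaller `b`,
write `a b = b a + [a, b]`: the second term gives products with fewer factors, and in the first one
a smaller commutator remains to be inserted. -/
theorem ringCommutator_mul_mem_orderedProductSpan (hlt : IsCommutatorOrder lt) (y : Fin t → A)
    (r : ℕ) (a : FreeMagma (Fin t)) (ha : IsBasicCommutator lt a) {n n' : ℕ}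
    (hn : n' = a.length + n) {x : A} (hx : x ∈ orderedProductSpan k lt y n r) :
    ringCommutator y a * x ∈ orderedProductSpan k lt y n' (r + 1) := by
  induction r using Nat.strong_induction_on generalizing a n n' x with
  | _ r ihr =>
  induction a using hlt.wellFounded.induction generalizing n n' x with
  | _ a iha =>
  refine mul_mem_of_mem_span_right hx ?_
  rintro _ ⟨l, hl, rfl, hlr, rfl⟩
  have easy : IsOrderedBasic lt (a :: l) →
      ringCommutator y a * (l.map (ringCommutator y)).prod ∈
        orderedProductSpan k lt y n' (r + 1) := fun h =>
    Submodule.subset_span ⟨a :: l, h, by simp [hn], by simpa using hlr, by simp⟩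
  cases l with
  | nil => exact easy (isOrderedBasic_cons.2 ⟨ha, by simp, hl⟩)
  | cons b l =>
    by_cases hba : lt b a
    · obtain ⟨hb, -, hl'⟩ := isOrderedBasic_cons.1 hl
      have hr : l.length + 1 ≤ r := by simpa using hlr
      have hmem : (l.map (ringCommutator y)).prod ∈
          orderedProductSpan k lt y (l.map FreeMagma.length).sum (r - 1) :=
        Submodule.subset_span ⟨l, hl', rfl, by omega, rfl⟩
      have hn' : n' = a.length + (b.length + (l.map FreeMagma.length).sum) := by simpa using hn
      rw [List.map_cons, List.prod_cons]
      have e : ∀ z : A, ringCommutator y a * (ringCommutator y b * z) =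
          ringCommutator y b * (ringCommutator y a * z) +
          (ringCommutator y a * ringCommutator y b - ringCommutator y b * ringCommutator y a) * z :=
        fun z => by noncomm_ring
      rw [e]
      refine add_mem ?_ ?_
      · have h1 := ihr (r - 1) (by omega) a ha rfl hmem
        rw [show r - 1 + 1 = r by omega] at h1
        exact iha b hba hb (by omega) h1
      · refine mul_mem_of_mem_span (ringCommutator_mul_mem_span hlt y ha hb) ?_
        rintro _ ⟨w, ⟨hw, hwl⟩, rfl⟩
        exact orderedProductSpan_mono (by omega)
          (ihr (r - 1) (by omega) w hw (n' := n') (by omega) hmem)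
    · exact easy (hl.cons_cons hlt ha hba)

/-- Words are combinations of ordered products of basic commutators of the same weight. -/
theorem prod_mem_orderedProductSpan (hlt : IsCommutatorOrder lt) (y : Fin t → A)
    (v : List (Fin t)) :
    (v.map y).prod ∈ orderedProductSpan k lt y v.length v.length := by
  induction v with
  | nil => exact Submodule.subset_span ⟨[], ⟨by simp, List.Pairwise.nil⟩, rfl, le_rfl, rfl⟩
  | cons i v ih =>
    rw [List.map_cons, List.prod_cons]
    exact ringCommutator_mul_mem_orderedProductSpan hlt y _ (.of i) trivial
      (by simp [FreeMagma.length, add_comm]) ih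

end Spanning

/-- The word obtained from a formal commutator by removing the brackets. -/
def foliage : FreeMagma (Fin t) → List (Fin t)
  | .of i => [i]
  | .mul a b => foliage a ++ foliage b

theorem length_foliage (w : FreeMagma (Fin t)) : (foliage w).length = w.length := by
  induction w with
  | ih1 i => rfl
  | ih2 a b iha ihb =>
    change (foliage a ++ foliage b).length = a.length + b.length
    rw [List.length_append, iha, ihb]

open Classical in
/-- Puts a formal commutator in front of a sequence, and collects as long as the first two entries
are in decreasing order: `a, b, …` with `a > b` becomes `[a, b], …`. -/
noncomputable def collect (lt : FreeMagma (Fin t) → FreeMagma (Fin t) → Prop) :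
    FreeMagma (Fin t) → List (FreeMagma (Fin t)) → List (FreeMagma (Fin t))
  | a, [] => [a]
  | a, b :: l => if lt b a then collect lt (a * b) l else a :: b :: l

/-- Collects the letters of a word, from right to left, in front of a sequence. -/
noncomputable def collectWord (lt : FreeMagma (Fin t) → FreeMagma (Fin t) → Prop)
    (v : List (Fin t)) (l : List (FreeMagma (Fin t))) : List (FreeMagma (Fin t)) :=
  v.foldr (fun i l => collect lt (.of i) l) l

theorem collectWord_append (v v' : List (Fin t)) (l : List (FreeMagma (Fin t))) :
    collectWord lt (v ++ v') l = collectWord lt v (collectWord lt v' l) :=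
  List.foldr_append

theorem collect_eq_cons {a : FreeMagma (Fin t)} {l : List (FreeMagma (Fin t))}
    (h : ∀ c ∈ l.head?, ¬ lt c a) : collect lt a l = a :: l := by
  cases l with
  | nil => rfl
  | cons b l => rw [collect, if_neg (h b rfl)]

/-- Collecting the letters of a basic commutator `w` recovers it. If `w = [p, q]`, the entry after
`w` must not be smaller than `q`, since `q` would be collected with it before `p` is reached. -/
theorem collectWord_foliage (hlt : IsCommutatorOrder lt) (w : FreeMagma (Fin t))
    (hw : IsBasicCommutator lt w) (l : List (FreeMagma (Fin t)))
    (h : ∀ p q, w = p * q → ∀ c ∈ l.head?, ¬ lt c q) :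
    collectWord lt (foliage w) l = collect lt w l := by
  induction w generalizing l with
  | ih1 i => rfl
  | ih2 a b iha ihb =>
    obtain ⟨ha, hb, hba, hab⟩ := hw
    change collectWord lt (foliage a ++ foliage b) l = _
    have hlb := h a b rfl
    rw [collectWord_append, ihb hb, collect_eq_cons hlb, iha ha, collect, if_pos hba]
    · rintro p q rfl c hc
      obtain rfl : b = c := by simpa using hc
      intro hbq
      rcases hab p q rfl with rfl | h'
      · exact hlt.irrefl _ hbq
      · exact hlt.irrefl _ (hlt.trans h' hbq)
    · rintro p q rfl c hc hcq
      refine hlb c hc (hlt.trans hcq (hlt.weight _ _ ?_))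
      have := p.length_pos
      change q.length < p.length + q.length
      omega

/-- A nondecreasing sequence of basic commutators is determined by the concatenation of their
words. -/
theorem collectWord_flatMap_foliage (hlt : IsCommutatorOrder lt) {l : List (FreeMagma (Fin t))}
    (hl : IsOrderedBasic lt l) : collectWord lt (l.flatMap foliage) [] = l := by
  induction l with
  | nil => rfl
  | cons a l ih =>
    obtain ⟨ha, hal, hl'⟩ := isOrderedBasic_cons.1 hl
    have hhead : ∀ c ∈ l.head?, ¬ lt c a := fun c hc => hal c (List.mem_of_mem_head? hc)
    rw [List.flatMap_cons, collectWord_append, ih hl', collectWord_foliage hlt a ha,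
      collect_eq_cons hhead]
    rintro p q rfl c hc hcq
    refine hhead c hc (hlt.trans hcq (hlt.weight _ _ ?_))
    have := p.length_pos
    change q.length < p.length + q.length
    omega

theorem length_flatMap_foliage (l : List (FreeMagma (Fin t))) :
    (l.flatMap foliage).length = (l.map FreeMagma.length).sum := by
  induction l with
  | nil => rfl
  | cons a l ih => simp [ih, length_foliage]

theorem linearIndependent_words (k : Type*) [CommRing k] :
    LinearIndependent k fun v : List (Fin t) => (v.map (FreeAlgebra.ι k)).prod := by
  have h := (FreeAlgebra.basisFreeMonoid k (Fin t)).linearIndependent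
  convert! h using 1
  funext v
  change _ = FreeAlgebra.basisFreeMonoid k (Fin t) (FreeMonoid.ofList v)
  simp [FreeAlgebra.basisFreeMonoid, FreeAlgebra.equivMonoidAlgebraFreeMonoid]

/-- Over any commutative ring, the basic commutators of a given weight are linearly independent in
the free associative algebra. The ordered products of basic commutators of weight `n` span the
homogeneous component of degree `n`, and there are no more of them than words of length `n`, so that
they are linearly independent. -/
theorem linearIndependent_ringCommutator (hlt : IsCommutatorOrder lt) (k : Type*) [CommRing k]
    (n : ℕ) : LinearIndependent k fun w : {w // IsBasicCommutator lt w ∧ w.length = n} =>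
      ringCommutator (FreeAlgebra.ι k) w.1 := by
  let S := {l : List (FreeMagma (Fin t)) // IsOrderedBasic lt l ∧ (l.map FreeMagma.length).sum = n}
  let toWord : S → List.Vector (Fin t) n := fun s =>
    ⟨s.1.flatMap foliage, (length_flatMap_foliage s.1).trans s.2.2⟩
  have hinj : Function.Injective toWord := by
    intro s s' h
    have h' : s.1.flatMap foliage = s'.1.flatMap foliage := congrArg Subtype.val h
    apply Subtype.ext
    rw [← collectWord_flatMap_foliage hlt s.2.1, h', collectWord_flatMap_foliage hlt s'.2.1]
  have : Finite S := Finite.of_injective toWord hinj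
  let P : S → FreeAlgebra k (Fin t) := fun s => (s.1.map (ringCommutator (FreeAlgebra.ι k))).prod
  let M := Submodule.span k (Set.range P)
  have : Module.Finite k M := Module.Finite.span_of_finite k (Set.finite_range P)
  have hword : ∀ s : S, ((s.1.flatMap foliage).map (FreeAlgebra.ι k)).prod ∈ M := by
    intro s
    have h1 := prod_mem_orderedProductSpan (k := k) hlt (FreeAlgebra.ι k) (s.1.flatMap foliage)
    refine Submodule.span_mono ?_ h1
    rintro x ⟨l, hl, hln, -, rfl⟩
    exact ⟨⟨l, hl, hln.trans ((length_flatMap_foliage s.1).trans s.2.2)⟩, rfl⟩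
  -- `i` is injective since its values are distinct words, `f` is surjective by the choice of `M`,
  -- and Orzech's theorem makes `f` injective
  let i : (S →₀ k) →ₗ[k] M := Finsupp.linearCombination k fun s => ⟨_, hword s⟩
  let f : (S →₀ k) →ₗ[k] M := Finsupp.linearCombination k fun s =>
    ⟨P s, Submodule.subset_span ⟨s, rfl⟩⟩
  have hi : Function.Injective i := by
    change LinearIndependent k _
    refine LinearIndependent.of_comp M.subtype ?_
    exact (linearIndependent_words k).comp (fun s : S => s.1.flatMap foliage)
      fun s s' h => hinj (Subtype.ext h)
  have hf : Function.Surjective f := by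
    rintro ⟨x, hx⟩
    obtain ⟨c, rfl⟩ : x ∈ LinearMap.range (Finsupp.linearCombination k P) := by
      rwa [Finsupp.range_linearCombination]
    exact ⟨c, Subtype.ext (Finsupp.apply_linearCombination k M.subtype _ c)⟩
  have key : LinearIndependent k P :=
    LinearIndependent.map' (f := M.subtype)
      (show LinearIndependent k _ from
        OrzechProperty.injective_of_surjective_of_injective i f hi hf)
      M.ker_subtype
  have h := key.comp (fun w : {w // IsBasicCommutator lt w ∧ w.length = n} =>
    (⟨[w.1], isOrderedBasic_cons.2 ⟨w.2.1, by simp, by simp [IsOrderedBasic]⟩,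
      by simpa using w.2.2⟩ : S)) fun w w' h => by
        have := congrArg Subtype.val h
        exact Subtype.ext (by simpa using this)
  convert! h using 1
  funext w
  simp [P]

end OrderedProducts

/-! ### Independence of the free presentation -/

section Invariance

/-- Two homomorphisms which agree modulo `N` agree on `γ_{n+1}` modulo `[N, ₙE]`. -/
theorem mul_inv_mem_iteratedCommutator {F E : Type*} [Group F] [Group E] {N : Subgroup E}
    [N.Normal] {φ ψ : F →* E} (h : ∀ x, ψ x * (φ x)⁻¹ ∈ N) (n : ℕ) {x : F}
    (hx : x ∈ (⊤ : Subgroup F).lowerCentralSeries n) :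
    ψ x * (φ x)⁻¹ ∈ iteratedCommutator N n := by
  induction n generalizing x with
  | zero => exact h x
  | succ n ih =>
    set D := iteratedCommutator N (n + 1)
    have key : (⊤ : Subgroup F).lowerCentralSeries (n + 1) ≤
        ((QuotientGroup.mk' D).comp ψ).eqLocus ((QuotientGroup.mk' D).comp φ) := by
      rw [Subgroup.lowerCentralSeries_succ, Subgroup.commutator_le]
      intro a ha g _
      have hφ : ∀ {y : F} {j : ℕ}, y ∈ (⊤ : Subgroup F).lowerCentralSeries j →
          φ y ∈ (⊤ : Subgroup E).lowerCentralSeries j := by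
        intro y j hy
        have := Subgroup.mem_map_of_mem φ hy
        rw [← iteratedCommutator_top] at this ⊢
        exact iteratedCommutator_map φ le_top j this
      have comm : ∀ {x y : E}, ⁅x, y⁆ ∈ D → Commute (x : E ⧸ D) (y : E ⧸ D) := by
        intro x y h
        rw [← commutatorElement_eq_one_iff_commute]
        exact mk_commutatorElement_eq_one_iff.2 h
      obtain ⟨z, hz, hza⟩ : ∃ z ∈ iteratedCommutator N n, ψ a = z * φ a :=
        ⟨_, ih ha, by group⟩
      obtain ⟨m, hm, hmg⟩ : ∃ m ∈ N, ψ g = m * φ g := ⟨_, h g, by group⟩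
      -- in the quotient by `[N, ₙ₊₁E]`, `z` is central and `m` commutes with `γ_{n+1}(E)`
      have hzc : ∀ y : E, Commute (z : E ⧸ D) (y : E ⧸ D) := fun y =>
        comm (Subgroup.commutator_mem_commutator hz (Subgroup.mem_top y))
      have hma : Commute (m : E ⧸ D) (φ a : E ⧸ D) := by
        have h1 := iteratedCommutator_commutator_lowerCentralSeries_le N 0 n
          (Subgroup.commutator_mem_commutator hm (hφ ha))
        rw [zero_add] at h1
        exact comm h1
      have hmc : Commute (m : E ⧸ D) (⁅φ a, φ g⁆ : E) := by
        have h1 := iteratedCommutator_commutator_lowerCentralSeries_le N 0 (n + 1)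
          (Subgroup.commutator_mem_commutator hm (hφ (y := ⁅a, g⁆) (j := n + 1)
            (Subgroup.commutator_mem_commutator ha (Subgroup.mem_top g))))
        rw [zero_add, map_commutatorElement] at h1
        exact comm (Subgroup.commutator_le_left _ _ h1)
      change ((ψ ⁅a, g⁆ : E) : E ⧸ D) = (φ ⁅a, g⁆ : E)
      rw [map_commutatorElement, map_commutatorElement, hza, hmg]
      have e1 : ⁅(z * φ a : E ⧸ D), (m * φ g : E ⧸ D)⁆ = ⁅(φ a : E ⧸ D), (m * φ g : E ⧸ D)⁆ := by
        have := hzc ⁅φ a, m * φ g⁆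
        have h2 := hzc (m * φ g)
        rw [commutatorElement_mul_left_eq_conj_mul]
        change (z : E ⧸ D) * (⁅φ a, m * φ g⁆ : E) * (z : E ⧸ D)⁻¹ *
          ⁅(z : E ⧸ D), ((m * φ g : E) : E ⧸ D)⁆ = (⁅φ a, m * φ g⁆ : E)
        rw [this.eq, mul_inv_cancel_right, commutatorElement_eq_one_iff_commute.2 h2, mul_one]
      have e2 : ⁅(φ a : E ⧸ D), (m * φ g : E ⧸ D)⁆ = ⁅(φ a : E ⧸ D), (φ g : E ⧸ D)⁆ := by
        rw [commutatorElement_mul_right_eq_mul_conj,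
          commutatorElement_eq_one_iff_commute.2 hma.symm, one_mul]
        change (m : E ⧸ D) * (⁅φ a, φ g⁆ : E) * (m : E ⧸ D)⁻¹ = (⁅φ a, φ g⁆ : E)
        rw [hmc.eq, mul_inv_cancel_right]
      exact e1.trans e2
    have := key hx
    change ((ψ x : E) : E ⧸ D) = (φ x : E) at this
    rw [← QuotientGroup.eq_one_iff, QuotientGroup.mk_mul, this, QuotientGroup.mk_inv,
      mul_inv_cancel]

variable {F₁ F₂ F₃ G : Type*} [Group F₁] [Group F₂] [Group F₃] [Group G]
  {π₁ : F₁ →* G} {π₂ : F₂ →* G} {π₃ : F₃ →* G}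

theorem map_mem_multiplierNumerator {f : F₁ →* F₂} (hf : π₂.comp f = π₁) {c : ℕ} {x : F₁}
    (hx : x ∈ multiplierNumerator π₁ c) : f x ∈ multiplierNumerator π₂ c := by
  refine ⟨?_, ?_⟩
  · have h1 : π₁ x = 1 := hx.1
    rw [← hf] at h1
    exact h1
  · have := Subgroup.mem_map_of_mem f hx.2
    rw [← iteratedCommutator_top] at this ⊢
    exact iteratedCommutator_map f le_top c this

/-- The homomorphism of higher Schur multiplicators induced by a homomorphism of presentations. -/
def multiplicatorMap (f : F₁ →* F₂) (hf : π₂.comp f = π₁) (c : ℕ) :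
    HigherSchurMultiplicator π₁ c →* HigherSchurMultiplicator π₂ c :=
  QuotientGroup.map _ _ ((f.comp (multiplierNumerator π₁ c).subtype).codRestrict
    (multiplierNumerator π₂ c) fun x => map_mem_multiplierNumerator hf x.2) <| by
      intro x hx
      have hker : π₁.ker.map f ≤ π₂.ker := by
        rw [Subgroup.map_le_iff_le_comap, ← hf]
        exact le_rfl
      exact iteratedCommutator_map f hker c (Subgroup.mem_map_of_mem f hx)

/-- Homomorphisms between two presentations of `G`, in opposite directions, induce inverse maps:
the composite endomorphism of `F₁` agrees with the identity modulo `ker π₁`, and therefore induces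
the identity. -/
theorem multiplicatorMap_comp_multiplicatorMap (f : F₁ →* F₂) (hf : π₂.comp f = π₁)
    (g : F₂ →* F₁) (hg : π₁.comp g = π₂) (c : ℕ) :
    (multiplicatorMap g hg c).comp (multiplicatorMap f hf c) = MonoidHom.id _ := by
  refine QuotientGroup.monoidHom_ext _ (MonoidHom.ext fun x => ?_)
  refine QuotientGroup.eq.2 ?_
  have h : ∀ y, (MonoidHom.id F₁) y * (g.comp f y)⁻¹ ∈ π₁.ker := by
    intro y
    have h1 : π₁ (g (f y)) = π₁ y := by
      conv_rhs => rw [← hf, ← hg]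
      rfl
    rw [MonoidHom.mem_ker, map_mul, map_inv]
    simp [h1]
  have h2 := mul_inv_mem_iteratedCommutator h c x.2.2
  have h3 := (inferInstance : (iteratedCommutator π₁.ker c).Normal).mem_comm h2
  exact h3

/-- The higher Schur multiplicator does not depend on the free presentation. -/
theorem nonempty_multiplicator_mulEquiv [IsFreeGroup F₁] [IsFreeGroup F₂]
    (h₁ : Function.Surjective π₁) (h₂ : Function.Surjective π₂) (c : ℕ) :
    Nonempty (HigherSchurMultiplicator π₁ c ≃* HigherSchurMultiplicator π₂ c) := by
  obtain ⟨f, hf⟩ : ∃ f : F₁ →* F₂, π₂.comp f = π₁ := by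
    choose s hs using h₂
    exact ⟨IsFreeGroup.lift fun a => s (π₁ (IsFreeGroup.of a)),
      IsFreeGroup.ext_hom fun a => by simp [IsFreeGroup.lift_of, hs]⟩
  obtain ⟨g, hg⟩ : ∃ g : F₂ →* F₁, π₁.comp g = π₂ := by
    choose s hs using h₁
    exact ⟨IsFreeGroup.lift fun a => s (π₂ (IsFreeGroup.of a)),
      IsFreeGroup.ext_hom fun a => by simp [IsFreeGroup.lift_of, hs]⟩
  exact ⟨(multiplicatorMap f hf c).toMulEquiv (multiplicatorMap g hg c)
    (multiplicatorMap_comp_multiplicatorMap f hf g hg c)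
    (multiplicatorMap_comp_multiplicatorMap g hg f hf c)⟩

end Invariance

/-! ### Cyclic groups and their tensor products -/

section CyclicGroups

theorem natCast_gcd_smul_eq_zero {M : Type*} [AddCommGroup M] {m n : ℕ} {x : M} (hm : m • x = 0)
    (hn : n • x = 0) : (Nat.gcd m n : ℤ) • x = 0 := by
  rw [Nat.gcd_eq_gcd_ab, add_smul, mul_comm, mul_smul, mul_comm (n : ℤ), mul_smul, natCast_zsmul,
    natCast_zsmul, hm, hn, smul_zero, smul_zero, add_zero]

theorem ZMod.tmul_eq_zsmul {m n : ℕ} (a : ZMod m) (b : ZMod n) :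
    a ⊗ₜ[ℤ] b = ((a.cast : ℤ) * (b.cast : ℤ)) • ((1 : ZMod m) ⊗ₜ[ℤ] (1 : ZMod n)) := by
  rw [mul_comm, mul_smul, TensorProduct.smul_tmul', ← TensorProduct.tmul_smul, zsmul_one, zsmul_one]
  simp

/-- `ℤ/m ⊗ ℤ/n ≃ ℤ/gcd(m, n)`. -/
theorem ZMod.nonempty_tensorProduct_equiv (m n : ℕ) :
    Nonempty (ZMod m ⊗[ℤ] ZMod n ≃+ ZMod (Nat.gcd m n)) := by
  let f : ZMod m ⊗[ℤ] ZMod n →ₗ[ℤ] ZMod (Nat.gcd m n) :=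
    TensorProduct.lift ((LinearMap.mul ℤ (ZMod (Nat.gcd m n))).compl₁₂
      (ZMod.castHom (Nat.gcd_dvd_left m n) _).toIntAlgHom.toLinearMap
      (ZMod.castHom (Nat.gcd_dvd_right m n) _).toIntAlgHom.toLinearMap)
  have h0 : (Nat.gcd m n : ℤ) • ((1 : ZMod m) ⊗ₜ[ℤ] (1 : ZMod n)) = 0 := by
    refine natCast_gcd_smul_eq_zero ?_ ?_
    · rw [TensorProduct.smul_tmul']; simp
    · rw [← TensorProduct.tmul_smul]; simp
  let g : ZMod (Nat.gcd m n) →+ ZMod m ⊗[ℤ] ZMod n :=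
    ZMod.lift _ ⟨zmultiplesHom _ ((1 : ZMod m) ⊗ₜ[ℤ] (1 : ZMod n)), h0⟩
  have hg : ∀ z : ℤ, g z = z • ((1 : ZMod m) ⊗ₜ[ℤ] (1 : ZMod n)) := fun z => ZMod.lift_coe _ _ z
  have hf1 : f ((1 : ZMod m) ⊗ₜ[ℤ] (1 : ZMod n)) = 1 := by
    have h : f ((1 : ZMod m) ⊗ₜ[ℤ] (1 : ZMod n)) =
        ZMod.castHom (Nat.gcd_dvd_left m n) _ 1 * ZMod.castHom (Nat.gcd_dvd_right m n) _ 1 :=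
      TensorProduct.lift.tmul _ _
    rw [h, map_one, map_one, one_mul]
  have hf : ∀ a b, f (a ⊗ₜ b) = ((a.cast * b.cast : ℤ) : ZMod (Nat.gcd m n)) := by
    intro a b
    rw [ZMod.tmul_eq_zsmul, map_zsmul, hf1]
    simp
  refine ⟨AddEquiv.ofBijective f.toAddMonoidHom ⟨?_, ?_⟩⟩
  · refine Function.LeftInverse.injective (g := g) fun x => ?_
    change g (f x) = x
    induction x with
    | zero => simp
    | tmul a b => rw [hf, hg, ← ZMod.tmul_eq_zsmul]
    | add x y hx hy => rw [map_add, map_add, hx, hy]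
  · intro z
    refine ⟨(z.cast : ℤ) • (1 ⊗ₜ 1), (map_zsmul f _ _).trans ?_⟩
    rw [hf1]
    simp

/-- Transport along additive equivalences; the `ℤ`-module structures of `M` and `N` are arbitrary,
as those bundled in `ModuleCat ℤ` are not syntactically the canonical ones. -/
theorem nonempty_tensorProduct_addEquiv {M N M' N' P : Type*} [AddCommGroup M] [AddCommGroup N]
    [AddCommGroup M'] [AddCommGroup N'] [AddCommGroup P]
    {m₁ : Module ℤ M} {m₂ : Module ℤ N} (e₁ : M ≃+ M') (e₂ : N ≃+ N') (e : M' ⊗[ℤ] N' ≃+ P) :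
    Nonempty (M ⊗[ℤ] N ≃+ P) := by
  obtain rfl : m₁ = AddCommGroup.toIntModule M := Subsingleton.elim _ _
  obtain rfl : m₂ = AddCommGroup.toIntModule N := Subsingleton.elim _ _
  exact ⟨(TensorProduct.congr e₁.toIntLinearEquiv e₂.toIntLinearEquiv).toAddEquiv.trans e⟩

/-- For cyclic groups, iterated tensor products are cyclic, of order the greatest common divisor of
the orders (for infinite groups, `Nat.card` is `0` and `ZMod 0 = ℤ`). -/
theorem nonempty_bracketedTensor_equiv {t : ℕ} (H : Fin t → Type u) [∀ i, CommGroup (H i)]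
    [∀ i, IsCyclic (H i)] (m : FreeMagma (Fin t)) :
    Nonempty (bracketedTensor H m ≃+ ZMod (gcdCard (fun i => Nat.card (H i)) m)) := by
  induction m with
  | ih1 i =>
    exact ⟨(zmodAddCyclicAddEquiv (G := Additive (H i)) inferInstance).symm⟩
  | ih2 a b iha ihb =>
    obtain ⟨ea⟩ := iha
    obtain ⟨eb⟩ := ihb
    obtain ⟨e⟩ := ZMod.nonempty_tensorProduct_equiv (gcdCard (fun i => Nat.card (H i)) a)
      (gcdCard (fun i => Nat.card (H i)) b)
    exact nonempty_tensorProduct_addEquiv ea eb e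

/-- An abelian group generated by elements `q w`, whose relations are generated by
`d w • q w = 0`, is the direct sum of the groups `ℤ/d w`. -/
theorem nonempty_directSum_zmod_addEquiv {W Q : Type*} [AddCommGroup Q] (d : W → ℕ) (q : W → Q)
    (hd : ∀ w, d w • q w = 0) (hq : AddSubgroup.closure (Set.range q) = ⊤)
    (hrel : ∀ (s : Finset W) (f : W → ℤ), ∑ w ∈ s, f w • q w = 0 → ∀ w ∈ s, (d w : ℤ) ∣ f w) :
    Nonempty ((⨁ w, ZMod (d w)) ≃+ Q) := by
  classical
  let φ : (w : W) → ZMod (d w) →+ Q := fun w =>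
    ZMod.lift (d w) ⟨zmultiplesHom Q (q w), by simpa using hd w⟩
  have hφ : ∀ w (z : ℤ), φ w z = z • q w := fun w z => ZMod.lift_coe _ _ z
  let Φ : (⨁ w, ZMod (d w)) →+ Q := DirectSum.toAddMonoid φ
  refine ⟨AddEquiv.ofBijective Φ ⟨?_, ?_⟩⟩
  · rw [injective_iff_map_eq_zero]
    intro x hx
    rw [← DirectSum.sum_support_of x, map_sum] at hx
    have hx' : ∑ w ∈ DFinsupp.support x, (((x w).cast : ℤ)) • q w = 0 := by
      rw [← hx]
      refine Finset.sum_congr rfl fun w _ => ?_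
      rw [DirectSum.toAddMonoid_of, ← hφ, ZMod.intCast_zmod_cast]
    ext w
    by_contra hw
    have h := hrel _ (fun w => ((x w).cast : ℤ)) hx' w (DFinsupp.mem_support_iff.2 hw)
    rw [← ZMod.intCast_zmod_eq_zero_iff_dvd, ZMod.intCast_zmod_cast] at h
    exact hw h
  · rw [← AddMonoidHom.range_eq_top, eq_top_iff, ← hq, AddSubgroup.closure_le]
    rintro _ ⟨w, rfl⟩
    refine ⟨DirectSum.of _ w ((1 : ℤ) : ZMod (d w)), ?_⟩
    rw [DirectSum.toAddMonoid_of, hφ, one_smul]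

end CyclicGroups

/-! ### The multiplicator of a product of cyclic groups -/

section StandardPresentation

variable {t : ℕ} {lt : FreeMagma (Fin t) → FreeMagma (Fin t) → Prop}
  (H : Fin t → Type u) [∀ i, CommGroup (H i)]

/-- The homomorphism from the free group of rank `t` to `∏ i, H i` with `x_i ↦ g_i ∈ H_i`, which is
a presentation when each `g_i` generates `H_i`. -/
def standardPresentation (g : ∀ i, H i) : FreeGroup (Fin t) →* ∀ i, H i :=
  FreeGroup.lift fun i => Pi.mulSingle i (g i)

variable {H}

theorem standardPresentation_of (g : ∀ i, H i) (i : Fin t) :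
    standardPresentation H g (FreeGroup.of i) = Pi.mulSingle i (g i) :=
  FreeGroup.lift_apply_of

theorem standardPresentation_surjective {g : ∀ i, H i}
    (hg : ∀ i (x : H i), x ∈ Subgroup.zpowers (g i)) :
    Function.Surjective (standardPresentation H g) := by
  rw [← MonoidHom.range_eq_top, eq_top_iff]
  intro x _
  rw [← Finset.univ_prod_mulSingle x]
  refine Subgroup.prod_mem _ fun i _ => ?_
  obtain ⟨n, hn⟩ := Subgroup.mem_zpowers_iff.1 (hg i (x i))
  refine ⟨FreeGroup.of i ^ n, ?_⟩
  rw [map_zpow, standardPresentation_of, ← hn, Pi.mulSingle_zpow]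

theorem of_pow_card_mem_ker (g : ∀ i, H i) (i : Fin t) :
    FreeGroup.of i ^ Nat.card (H i) ∈ (standardPresentation H g).ker := by
  rw [MonoidHom.mem_ker, map_pow, standardPresentation_of, ← Pi.mulSingle_pow, pow_card_eq_one',
    Pi.mulSingle_one]

theorem commutator_le_ker {F G : Type*} [Group F] [CommGroup G] (π : F →* G) :
    ⁅(⊤ : Subgroup F), ⊤⁆ ≤ π.ker :=
  Abelianization.commutator_subset_ker π

/-- If `|H_i| • y_i = 0` for all `i`, the Magnus representation `x_i ↦ 1 + y_i X` maps the
relations of `∏ i, H i` to units of the form `1 + a X² + ⋯`. -/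
theorem exists_hasLeadingTerm_magnus_of_mem_ker {A : Type*} [Ring A] {g : ∀ i, H i}
    (hg : ∀ i (x : H i), x ∈ Subgroup.zpowers (g i)) {y : Fin t → A}
    (hy : ∀ i, Nat.card (H i) • y i = 0) {r : FreeGroup (Fin t)}
    (hr : r ∈ (standardPresentation H g).ker) : ∃ a, HasLeadingTerm (magnus y r) 2 a := by
  -- `x_i ↦ y_i` factors through `∏ i, H i`, so that the coefficient of `X` vanishes on the kernel
  let χ : ∀ i, H i →* Multiplicative A := fun i =>
    monoidHomOfForallMemZpowers (hg i) (g' := Multiplicative.ofAdd (y i)) <| by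
      rw [orderOf_eq_card_of_forall_mem_zpowers (hg i)]
      exact orderOf_dvd_of_pow_eq_one (congrArg Multiplicative.ofAdd (hy i))
  let ψ : (∀ i, H i) →* Multiplicative A := ∏ i, (χ i).comp (Pi.evalMonoidHom H i)
  have hψ : ∀ i, ψ (Pi.mulSingle i (g i)) = Multiplicative.ofAdd (y i) := by
    intro i
    rw [MonoidHom.finsetProd_apply, Finset.prod_eq_single i]
    · simp [χ]
    · intro j _ hji
      simp [Pi.mulSingle_eq_of_ne hji]
    · simp
  have main : ∀ r, HasLeadingTerm (magnus y r) 1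
      (Multiplicative.toAdd (ψ (standardPresentation H g r))) := by
    have hof : ∀ i, HasLeadingTerm (magnus y (FreeGroup.of i)) 1
        (Multiplicative.toAdd (ψ (standardPresentation H g (FreeGroup.of i)))) := by
      intro i
      rw [standardPresentation_of, hψ]
      exact hasLeadingTerm_magnus_groupCommutator y (.of i)
    intro r
    induction r using FreeGroup.induction_on with
    | C1 => simpa using HasLeadingTerm.one 1
    | of i => exact hof i
    | inv_of i _ => simpa using (hof i).inv one_ne_zero
    | mul a b ha hb => simpa using ha.mul hb one_ne_zero
  have h := main r
  rw [MonoidHom.mem_ker.1 hr, map_one, toAdd_one] at h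
  exact h.exists_succ

/-- Scaling the letters by `e_i` scales a formal commutator by the product of the `e_i` over its
letters, which is `FreeMagma.lift e`. -/
theorem ringCommutator_smul {k A : Type*} [CommRing k] [Ring A] [Algebra k A] (e : Fin t → k)
    (y : Fin t → A) (m : FreeMagma (Fin t)) :
    ringCommutator (fun i => e i • y i) m = FreeMagma.lift e m • ringCommutator y m := by
  induction m with
  | ih1 i => rfl
  | ih2 a b iha ihb =>
    rw [map_mul]
    change ringCommutator _ a * ringCommutator _ b - ringCommutator _ b * ringCommutator _ a =
      _ • (_ * _ - _ * _)
    rw [iha, ihb, smul_mul_smul_comm, smul_mul_smul_comm, smul_sub, mul_comm (FreeMagma.lift e b)]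

/-- If `d` divides `gcdCard N m`, every letter of `m` has `d ∣ N i`, so that killing the other letters
does not affect `m`. -/
theorem lift_ite_dvd_eq_one {k : Type*} [CommRing k] {N : Fin t → ℕ} {d : ℕ}
    (m : FreeMagma (Fin t)) (h : d ∣ gcdCard N m) :
    FreeMagma.lift (fun i => if d ∣ N i then (1 : k) else 0) m = 1 := by
  induction m with
  | ih1 i => exact if_pos h
  | ih2 a b iha ihb =>
    have h' : d ∣ (gcdCard N a).gcd (gcdCard N b) := h
    rw [map_mul, iha (h'.trans (Nat.gcd_dvd_left _ _)), ihb (h'.trans (Nat.gcd_dvd_right _ _)),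
      one_mul]

theorem lowerCentralSeries_le_multiplierNumerator {F G : Type*} [Group F] [CommGroup G]
    (π : F →* G) {c : ℕ} (hc : 1 ≤ c) :
    (⊤ : Subgroup F).lowerCentralSeries c ≤ multiplierNumerator π c :=
  le_inf ((Subgroup.lowerCentralSeries_antitone _ hc).trans (commutator_le_ker π)) le_rfl

theorem multiplicator_mul_comm {F G : Type*} [Group F] [CommGroup G] (π : F →* G) {c : ℕ}
    (a b : HigherSchurMultiplicator π c) : a * b = b * a := by
  induction a using QuotientGroup.induction_on with
  | H a =>
  induction b using QuotientGroup.induction_on with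
  | H b =>
  refine commutatorElement_eq_one_iff_mul_comm.1 (mk_commutatorElement_eq_one_iff.2 ?_)
  exact lowerCentralSeries_succ_le_iteratedCommutator (commutator_le_ker π) c
    (commutatorElement_mem_lowerCentralSeries a.2.2 b.2.2 (by omega))

/-- The theorem for the standard presentation. A relation between the classes of the basic
commutators is mapped, by the Magnus representation over `ℤ/d`, to a relation between linearly
independent elements; for the coefficient of `w` one takes for `d` the order of `H_w` and kills the
letters for which `d` does not divide `|H_i|`. -/
theorem nonempty_multiplicator_standardPresentation_mulEquiv [∀ i, IsCyclic (H i)]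
    {g : ∀ i, H i} (hg : ∀ i (x : H i), x ∈ Subgroup.zpowers (g i)) {c : ℕ} (hc : 1 ≤ c)
    (hlt : IsCommutatorOrder lt) :
    Nonempty (HigherSchurMultiplicator (standardPresentation H g) c ≃*
      Multiplicative (BasicTensorSum lt H (c + 1))) := by
  classical
  set π := standardPresentation H g
  set N : Fin t → ℕ := fun i => Nat.card (H i)
  let W := {w : FreeMagma (Fin t) // IsBasicCommutator lt w ∧ w.length = c + 1}
  have hΓ := lowerCentralSeries_le_multiplierNumerator π hc
  have hR := commutator_le_ker π
  let num : W → multiplierNumerator π c := fun w =>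
    ⟨groupCommutator FreeGroup.of w.1, hΓ (groupCommutator_mem_lowerCentralSeries _ _ w.2.2)⟩
  let q : W → HigherSchurMultiplicator π c := fun w => QuotientGroup.mk (num w)
  let _ : CommGroup (HigherSchurMultiplicator π c) :=
    { (inferInstance : Group (HigherSchurMultiplicator π c)) with
      mul_comm := multiplicator_mul_comm π }
  have hpow : ∀ w : W, gcdCard N w.1 • Additive.ofMul (q w) = 0 := by
    intro w
    refine congrArg Additive.ofMul ((QuotientGroup.eq_one_iff (num w ^ gcdCard N w.1)).2 ?_)
    exact groupCommutator_pow_mem π.ker hR (of_pow_card_mem_ker g) w.1 w.2.2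
  have hgen : AddSubgroup.closure (Set.range fun w => Additive.ofMul (q w)) = ⊤ := by
    rw [eq_top_iff]
    rintro x -
    obtain ⟨z, hz⟩ := QuotientGroup.mk_surjective (Additive.toMul x)
    let L := AddSubgroup.toSubgroup' (AddSubgroup.closure (Set.range fun w => Additive.ofMul (q w)))
    have h : basicCommutatorSubgroup lt FreeGroup.of c ≤
        (L.comap (QuotientGroup.mk' _)).map (multiplierNumerator π c).subtype := by
      refine basicCommutatorSubgroup_le_iff.2 ⟨fun w hw hwl => ?_, fun r hr => ?_⟩
      · exact ⟨num ⟨w, hw, hwl⟩, AddSubgroup.subset_closure ⟨⟨w, hw, hwl⟩, rfl⟩, rfl⟩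
      · refine ⟨⟨r, hΓ (Subgroup.lowerCentralSeries_antitone _ c.le_succ hr)⟩, ?_, rfl⟩
        have h1 := (QuotientGroup.eq_one_iff (N := (iteratedCommutator π.ker c).subgroupOf _)
          (⟨r, hΓ (Subgroup.lowerCentralSeries_antitone _ c.le_succ hr)⟩ :
            multiplierNumerator π c)).2 (lowerCentralSeries_succ_le_iteratedCommutator hR c hr)
        rw [SetLike.mem_coe, Subgroup.mem_comap, QuotientGroup.mk'_apply, h1]
        exact one_mem L
    rw [basicCommutatorSubgroup_eq_lowerCentralSeries hlt (FreeGroup.closure_range_of _)] at h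
    obtain ⟨z', hz', hzz⟩ := h z.2.2
    obtain rfl : z' = z := Subtype.ext hzz
    rw [SetLike.mem_coe, Subgroup.mem_comap, QuotientGroup.mk'_apply, hz] at hz'
    exact hz'
  have hrel : ∀ (s : Finset W) (f : W → ℤ), ∑ w ∈ s, f w • Additive.ofMul (q w) = 0 →
      ∀ w ∈ s, (gcdCard N w.1 : ℤ) ∣ f w := by
    intro s f hf w hw
    set d := gcdCard N w.1 with hd
    -- keep the letters with `d ∣ |H_i|`, among them those of `w`, and kill the others: this makes
    -- `|H_i| • y_i = 0`
    let e : Fin t → ZMod d := fun i => if d ∣ N i then 1 else 0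
    let y : Fin t → FreeAlgebra (ZMod d) (Fin t) := fun i => e i • FreeAlgebra.ι (ZMod d) i
    have hy : ∀ i, Nat.card (H i) • y i = 0 := by
      intro i
      by_cases hi : d ∣ N i
      · have : ((N i : ℕ) : ZMod d) = 0 := (ZMod.natCast_eq_zero_iff _ _).2 hi
        rw [← Nat.cast_smul_eq_nsmul (ZMod d), this, zero_smul]
      · simp [y, e, hi]
    let Λ₀ : multiplierNumerator π c →* Multiplicative (FreeAlgebra (ZMod d) (Fin t)) :=
      (leadingCoeffHom c).comp (((magnus y).comp (multiplierNumerator π c).subtype).codRestrict _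
        fun z => by
          obtain ⟨a, ha⟩ := exists_hasLeadingTerm_magnus_of_mem_lowerCentralSeries y z.2.2
          exact ⟨a, trivial, ha⟩)
    have hΛ₀ : ∀ (z : multiplierNumerator π c) {a}, HasLeadingTerm (magnus y z) (c + 1) a →
        Λ₀ z = Multiplicative.ofAdd a := fun z a h => leadingCoeffHom_eq h
    let Λ : HigherSchurMultiplicator π c →* Multiplicative (FreeAlgebra (ZMod d) (Fin t)) :=
      QuotientGroup.lift _ Λ₀ fun z hz => by
        obtain ⟨a, ha⟩ := exists_hasLeadingTerm_magnus_of_mem_iteratedCommutator y (k := 1)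
          (fun r hr => exists_hasLeadingTerm_magnus_of_mem_ker hg hy hr)
          (Subgroup.mem_subgroupOf.1 hz)
        rw [add_comm 1 c] at ha
        exact hΛ₀ z ha.succ
    have hΛ : ∀ w : W, MonoidHom.toAdditiveLeft Λ (Additive.ofMul (q w)) =
        FreeMagma.lift e w.1 • ringCommutator (FreeAlgebra.ι (ZMod d)) w.1 := by
      intro w
      have h := hasLeadingTerm_magnus_groupCommutator y w.1
      rw [ringCommutator_smul, w.2.2] at h
      exact hΛ₀ (num w) h
    have h := congrArg (MonoidHom.toAdditiveLeft Λ) hf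
    rw [map_sum, map_zero] at h
    have h' : ∑ w ∈ s, ((f w : ZMod d) * FreeMagma.lift e w.1) •
        ringCommutator (FreeAlgebra.ι (ZMod d)) w.1 = 0 := by
      rw [← h]
      refine Finset.sum_congr rfl fun w _ => ?_
      rw [map_zsmul, hΛ, mul_smul, Int.cast_smul_eq_zsmul]
    have h0 := linearIndependent_iff'.1
      (linearIndependent_ringCommutator hlt (ZMod d) (c + 1)) s _ h' w hw
    rw [lift_ite_dvd_eq_one w.1 hd.dvd, mul_one] at h0
    exact (ZMod.intCast_zmod_eq_zero_iff_dvd _ _).1 h0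
  obtain ⟨E⟩ := nonempty_directSum_zmod_addEquiv (fun w : W => gcdCard N w.1)
    (fun w => Additive.ofMul (q w)) hpow hgen hrel
  let T := fun w : W => (nonempty_bracketedTensor_equiv H w.1).some
  let E' : BasicTensorSum lt H (c + 1) ≃+ ⨁ w : W, ZMod (gcdCard N w.1) :=
    DFinsupp.mapRange.addEquiv T
  exact ⟨AddEquiv.toMultiplicativeRight (E'.trans E).symm⟩

end StandardPresentation

theorem theorem2p3 {t : ℕ} (H : Fin t → Type u) [∀ i, CommGroup (H i)] [∀ i, IsCyclic (H i)]
    [∀ i, Finite (H i)] (c : ℕ) (hc : 1 ≤ c)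
    (lt : FreeMagma (Fin t) → FreeMagma (Fin t) → Prop) (hlt : IsCommutatorOrder lt)
    (F : Type v) [Group F] [IsFreeGroup F] (π : F →* (∀ i, H i)) (hπ : Function.Surjective π) :
    Nonempty (HigherSchurMultiplicator π c ≃* Multiplicative (BasicTensorSum lt H (c + 1))) := by
  choose g hg using fun i => IsCyclic.exists_generator (α := H i)
  obtain ⟨e⟩ := nonempty_multiplicator_mulEquiv hπ (standardPresentation_surjective hg) c
  obtain ⟨e'⟩ := nonempty_multiplicator_standardPresentation_mulEquiv hg hc hlt
  exact ⟨e.trans e'⟩
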